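/- For $a>-1$ let $L^r_a$ ($1\le r<\infty$) be the Lebesgue space on $\mathbb R^+=(0,\infty)$ with respect to $d\omega_a(x)=x^a\,dx$, so that $\|f\|_{L^r_a}=\big(\int_0^\infty |f(x)|^r x^a\,dx\big)^{1/r}$. Let $\mathscr S^+$ be the space of all $\varphi\in C^\infty(\mathbb R^+;\mathbb C)$ such that $\sup_{x>0}\big|x^m\big(\tfrac1x\partial_x\big)^k\varphi(x)\big|<\infty$ for all $m,k\in\mathbb N_0$. For $x,y>0$ and $t\ne 0$ put $$S_a(x,y,t)=\frac{e^{\mp i\frac{(a+1)\pi}{4}}}{(2|t|)^{\frac{a+1}{2}}}\Big(\frac{xy}{2|t|}\Big)^{\frac{1-a}{2}}J_{\frac{a-1}{2}}\Big(\frac{xy}{2|t|}\Big)e^{\pm i\frac{x^2+y^2}{4|t|}},$$ with the upper signs for $t>0$ and the lower signs for $t<0$, where $J_\nu$ is the Bessel function of the first kind of order $\nu$, and for $\varphi\in\mathscr S^+$ let $$S_a(t)\varphi(x)=\int_0^\infty S_a(x,y,t)\varphi(y)\,d\omega_a(y),\qquad x>0.$$ Let $2\le r<\infty$ and $\frac1r+\frac1{r'}=1$.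 (i) For every $a\ge 0$ there exists a constant $C=C(a,r)>0$ such that, for every $\varphi\in\mathscr S^+$ and every $t\in\mathbb R\setminus\{0\}$, the integral defining $S_a(t)\varphi(x)$ converges absolutely for every $x>0$, $S_a(t)\varphi\in L^r_a$, and $$\|S_a(t)\varphi\|_{L^r_a}\le C\,|t|^{-(a+1)\left(\frac12-\frac1r\right)}\|\varphi\|_{L^{r'}_a}.$$ (ii) For every $-1<a<0$ there exists a constant $C=C(a,r)>0$ such that, with $k_1(x)=\min\{1,x^{a/2}\}$, for every $\varphi\in\mathscr S^+$ and every $t\in\mathbb R\setminus\{0\}$, the integral defining $S_a(t)\varphi(x)$ converges absolutely for every $x>0$, $S_a(t)\varphi\,k_1^{1-\frac2r}\in L^r_a$, and $$\big\|S_a(t)\varphi\,k_1^{1-\frac2r}\big\|_{L^r_a}\le C\Big\{|t|^{-(a+1)\left(\frac12-\frac1r\right)}+|t|^{-\left(\frac12-\frac1r\right)}\Big\}\big\|\varphi\,k_1^{1-\frac2{r'}}\big\|_{L^{r'}_a}.$$ -/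

import Mathlib

open MeasureTheory Set
open scoped ENNReal ContDiff

noncomputable section

namespace BesselSchrodinger

/-- The Bessel function of the first kind `J_ν(z)`, for real order `ν` and `z > 0`:
`∑ₖ (-1)^k / (Γ(k+1) Γ(ν+k+1)) (z/2)^(2k+ν)`. -/
def besselJ (ν z : ℝ) : ℝ :=
  ∑' k : ℕ, (-1 : ℝ) ^ k / (Real.Gamma (k + 1) * Real.Gamma (ν + k + 1)) *
    (z / 2) ^ (2 * (k : ℝ) + ν)

/-- The measure `dω_a(x) = x^a dx` on the half-line `(0, ∞)`, as a measure on `ℝ` carried by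
`(0, ∞)`. -/
def omega (a : ℝ) : Measure ℝ :=
  (volume.restrict (Ioi (0 : ℝ))).withDensity fun x => ENNReal.ofReal (x ^ a)

/-- The operator `f ↦ (1/x) ∂ₓ f`. -/
def invXDeriv (f : ℝ → ℂ) : ℝ → ℂ := fun x => (1 / (x : ℂ)) * deriv f x

/-- The space `𝒮⁺` of smooth functions `φ` on `(0, ∞)` with
`sup_{x > 0} |x^m ((1/x) ∂ₓ)^k φ(x)| < ∞` for all `m, k ∈ ℕ₀`. Functions on `(0, ∞)` are
represented by functions on `ℝ`, whose values on `(-∞, 0]` play no role. -/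
structure SchwartzPlus (φ : ℝ → ℂ) : Prop where
  smooth : ContDiffOn ℝ ∞ φ (Ioi 0)
  bounded : ∀ m k : ℕ, ∃ M : ℝ, ∀ x : ℝ, 0 < x → ‖(x : ℂ) ^ m * (invXDeriv^[k] φ) x‖ ≤ M

/-- The kernel `S_a(x, y, t)`, for `x, y > 0` and `t ≠ 0` (the value at `t = 0` is immaterial). -/
def kernel (a x y t : ℝ) : ℂ :=
  if t < 0 then
    Complex.exp (Complex.I * (((a + 1) * Real.pi / 4 : ℝ) : ℂ)) /
        (((2 * |t|) ^ ((a + 1) / 2) : ℝ) : ℂ) *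
      (((x * y / (2 * |t|)) ^ ((1 - a) / 2) * besselJ ((a - 1) / 2) (x * y / (2 * |t|)) : ℝ) : ℂ) *
      Complex.exp (-Complex.I * (((x ^ 2 + y ^ 2) / (4 * |t|) : ℝ) : ℂ))
  else
    Complex.exp (-Complex.I * (((a + 1) * Real.pi / 4 : ℝ) : ℂ)) /
        (((2 * |t|) ^ ((a + 1) / 2) : ℝ) : ℂ) *
      (((x * y / (2 * |t|)) ^ ((1 - a) / 2) * besselJ ((a - 1) / 2) (x * y / (2 * |t|)) : ℝ) : ℂ) *
      Complex.exp (Complex.I * (((x ^ 2 + y ^ 2) / (4 * |t|) : ℝ) : ℂ))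

/-- `S_a(t)φ(x) = ∫₀^∞ S_a(x, y, t) φ(y) dω_a(y)`. -/
def propagator (a t : ℝ) (φ : ℝ → ℂ) : ℝ → ℂ :=
  fun x => ∫ y, kernel a x y t * φ y ∂(omega a)

/-- The weight `k₁(x) = min {1, x^(a/2)}`. -/
def k₁ (a x : ℝ) : ℝ := min 1 (x ^ (a / 2))

/-- Multiplication of `f` by the power `k₁^s` of the weight. -/
def weighted (a s : ℝ) (f : ℝ → ℂ) : ℝ → ℂ := fun x => f x * ((k₁ a x ^ s : ℝ) : ℂ)

/-- The norm of `L^r_a`, with values in `[0, ∞]`, for `1 ≤ r < ∞`. -/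
def normLa (a r : ℝ) (f : ℝ → ℂ) : ℝ≥0∞ := eLpNorm f (ENNReal.ofReal r) (omega a)

/-- Membership in `L^r_a`, for `1 ≤ r < ∞`. -/
def MemLa (a r : ℝ) (f : ℝ → ℂ) : Prop := MemLp f (ENNReal.ofReal r) (omega a)

end BesselSchrodinger

end

/-!
Writing `x y / (2 t)` as the cross term of `(x - y)² / (4 t)` shows that `S_a(t)` is, up to
multiplication by the unimodular chirps `e^(i x² / (4 t))`, a dilated Hankel transform.
* `L² → L²`: inserting a Gaussian factor `e^(-ε y²)` in the Hankel transform, Weber's second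
  exponential integral identifies the resulting `T T*` as an integral operator whose kernel is a
  heat kernel of mass one. Schur's test bounds it by `1`, uniformly in `ε`, so the Hankel transform
  is a contraction.
* `L¹ → L^∞`: bounds on `J_ν` control the kernel, for `a < 0` after multiplication by the weight
  `k₁` in each variable, because the kernel then grows like `(x y)^(-a / 2)`.
The two endpoints are joined by real interpolation; the weight `κ` is absorbed by replacing `ω_a`
with `κ⁻² ω_a`, which turns the weighted estimate into an unweighted one.
-/

noncomputable section

namespace BesselSchrodinger

open Real Filter Topology

section SchurTest

variable {α β 𝕜 : Type*} [MeasurableSpace α] [MeasurableSpace β] {μ : Measure α} {ν : Measure β}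

lemma lintegral_symm_mul_mul_le [SFinite ν] {G : β → β → ℝ≥0∞} {f : β → ℝ≥0∞} {C : ℝ≥0∞}
    (hGm : Measurable (Function.uncurry G)) (hf : Measurable f) (hGs : ∀ y z, G y z = G z y)
    (hG : ∀ y, ∫⁻ z, G y z ∂ν ≤ C) :
    ∫⁻ p, G p.1 p.2 * (f p.1 * f p.2) ∂ν.prod ν ≤ C * ∫⁻ y, f y ^ 2 ∂ν := by
  have hm : Measurable fun p : β × β => G p.1 p.2 * f p.1 ^ 2 :=
    hGm.mul ((hf.comp measurable_fst).pow_const 2)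
  have hrow : ∫⁻ p, G p.1 p.2 * f p.1 ^ 2 ∂ν.prod ν ≤ C * ∫⁻ y, f y ^ 2 ∂ν := by
    rw [lintegral_prod _ hm.aemeasurable,
      ← lintegral_const_mul _ (hf.pow_const 2)]
    refine lintegral_mono fun y => ?_
    simp only [lintegral_mul_const _ hGm.of_uncurry_left]
    gcongr
    exact hG y
  have hcol : ∫⁻ p, G p.1 p.2 * f p.2 ^ 2 ∂ν.prod ν = ∫⁻ p, G p.1 p.2 * f p.1 ^ 2 ∂ν.prod ν := by
    rw [← lintegral_prod_swap]
    simp only [Prod.fst_swap, Prod.snd_swap, hGs]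
  have hyoung (u v : ℝ≥0∞) : u * v ≤ 2⁻¹ * u ^ 2 + 2⁻¹ * v ^ 2 := by
    simpa [div_eq_mul_inv, mul_comm] using ENNReal.young_inequality u v HolderConjugate.two_two
  calc ∫⁻ p, G p.1 p.2 * (f p.1 * f p.2) ∂ν.prod ν
      ≤ ∫⁻ p, (2⁻¹ * (G p.1 p.2 * f p.1 ^ 2) + 2⁻¹ * (G p.1 p.2 * f p.2 ^ 2)) ∂ν.prod ν :=
        lintegral_mono fun p => (mul_le_mul_right (hyoung _ _) _).trans_eq (by ring)
    _ = 2⁻¹ * ∫⁻ p, G p.1 p.2 * f p.1 ^ 2 ∂ν.prod ν +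
          2⁻¹ * ∫⁻ p, G p.1 p.2 * f p.1 ^ 2 ∂ν.prod ν := by
        rw [lintegral_add_left (hm.const_mul _), lintegral_const_mul _ hm,
          lintegral_const_mul' _ _ (by simp), hcol]
    _ ≤ C * ∫⁻ y, f y ^ 2 ∂ν := by
        rwa [← add_mul, ENNReal.inv_two_add_inv_two, one_mul]

variable [RCLike 𝕜]

open ComplexConjugate

lemma lintegral_enorm_integral_sq_le [SFinite μ] [SFinite ν] {K : α → β → 𝕜} {h : β → 𝕜}
    {C : ℝ≥0∞} (hK : Measurable (Function.uncurry K)) (hh : Measurable h)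
    (hint : Integrable (fun p : α × β × β => K p.1 p.2.1 * conj (K p.1 p.2.2) *
      (h p.2.1 * conj (h p.2.2))) (μ.prod (ν.prod ν)))
    (hG : ∀ y, ∫⁻ z, ‖∫ x, K x y * conj (K x z) ∂μ‖ₑ ∂ν ≤ C) :
    ∫⁻ x, ‖∫ y, K x y * h y ∂ν‖ₑ ^ 2 ∂μ ≤ C * ∫⁻ y, ‖h y‖ₑ ^ 2 ∂ν := by
  set T : α → 𝕜 := fun x => ∫ y, K x y * h y ∂ν
  set G : β → β → 𝕜 := fun y z => ∫ x, K x y * conj (K x z) ∂μ with hGdef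
  have hGm : Measurable (Function.uncurry G) := by
    refine (StronglyMeasurable.integral_prod_right'
      (f := fun q : (β × β) × α => K q.2 q.1.1 * conj (K q.2 q.1.2)) ?_).measurable
    exact ((hK.comp (measurable_snd.prodMk measurable_fst.fst)).mul
      (RCLike.continuous_conj.measurable.comp
        (hK.comp (measurable_snd.prodMk measurable_fst.snd)))).stronglyMeasurable
  have hGs (y z : β) : ‖G y z‖ₑ = ‖G z y‖ₑ := by
    rw [← RCLike.enorm_conj (G z y), hGdef]
    simp only [← integral_conj, map_mul, RCLike.conj_conj, mul_comm]
  have hT (x : α) : ∫ p : β × β, K x p.1 * conj (K x p.2) * (h p.1 * conj (h p.2)) ∂ν.prod ν =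
      ((‖T x‖ ^ 2 : ℝ) : 𝕜) := by
    rw [RCLike.ofReal_pow, ← RCLike.mul_conj, ← integral_conj, ← integral_prod_mul]
    simp only [map_mul, mul_mul_mul_comm]
  have hTint : Integrable (fun x => ‖T x‖ ^ 2) μ := by
    have := hint.integral_prod_left.re
    simpa only [hT, RCLike.ofReal_re] using this
  calc ∫⁻ x, ‖T x‖ₑ ^ 2 ∂μ
      = ‖∫ x, ((‖T x‖ ^ 2 : ℝ) : 𝕜) ∂μ‖ₑ := by
        rw [integral_ofReal, ← ofReal_norm, RCLike.norm_ofReal, abs_of_nonneg (by positivity),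
          ofReal_integral_eq_lintegral_ofReal hTint (ae_of_all _ fun x => by positivity)]
        simp only [ENNReal.ofReal_pow (norm_nonneg _), ofReal_norm]
    _ = ‖∫ p : β × β, G p.1 p.2 * (h p.1 * conj (h p.2)) ∂ν.prod ν‖ₑ := by
        simp only [← hT]
        rw [integral_integral_swap hint]
        simp only [integral_mul_const, hGdef]
    _ ≤ ∫⁻ p : β × β, ‖G p.1 p.2‖ₑ * (‖h p.1‖ₑ * ‖h p.2‖ₑ) ∂ν.prod ν := by
        refine (enorm_integral_le_lintegral_enorm _).trans_eq ?_
        simp only [enorm_mul, RCLike.enorm_conj]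
    _ ≤ C * ∫⁻ y, ‖h y‖ₑ ^ 2 ∂ν :=
        lintegral_symm_mul_mul_le hGm.enorm hh.enorm hGs hG

lemma integrable_mul_conj_mul_mul_conj {K : α → β → 𝕜} {h : β → 𝕜} {A : α → ℝ} {B : β → ℝ}
    (hK : Measurable (Function.uncurry K)) (hh : Measurable h)
    (hKAB : ∀ x y, ‖K x y‖ ≤ A x * B y) (hA : Integrable (fun x => A x ^ 2) μ)
    (hB : Integrable (fun y => B y * ‖h y‖) ν) :
    Integrable (fun p : α × β × β => K p.1 p.2.1 * conj (K p.1 p.2.2) *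
      (h p.2.1 * conj (h p.2.2))) (μ.prod (ν.prod ν)) := by
  refine (hA.mul_prod (hB.mul_prod hB)).mono' (Measurable.aestronglyMeasurable ?_)
    (ae_of_all _ fun p => ?_)
  · have hconj := RCLike.continuous_conj (K := 𝕜) |>.measurable
    exact ((hK.comp (measurable_fst.prodMk measurable_snd.fst)).mul
      (hconj.comp (hK.comp (measurable_fst.prodMk measurable_snd.snd)))).mul
      ((hh.comp measurable_snd.fst).mul (hconj.comp (hh.comp measurable_snd.snd)))
  · obtain ⟨x, y, z⟩ := p
    simp only [norm_mul, RCLike.norm_conj]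
    calc ‖K x y‖ * ‖K x z‖ * (‖h y‖ * ‖h z‖)
        ≤ (A x * B y) * (A x * B z) * (‖h y‖ * ‖h z‖) := by
          have := (norm_nonneg _).trans (hKAB x y)
          gcongr <;> exact hKAB _ _
      _ = A x ^ 2 * (B y * ‖h y‖ * (B z * ‖h z‖)) := by ring

end SchurTest

section RealInterpolation

lemma lintegral_Ioc_rpow {r L : ℝ} (hr : -1 < r) (hL : 0 ≤ L) :
    ∫⁻ l in Ioc 0 L, ENNReal.ofReal (l ^ r) = ENNReal.ofReal (L ^ (r + 1) / (r + 1)) := by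
  rw [← ofReal_integral_eq_lintegral_ofReal, ← intervalIntegral.integral_of_le hL,
    integral_rpow (Or.inl hr), zero_rpow (by linarith), sub_zero]
  · exact (intervalIntegrable_iff_integrableOn_Ioc_of_le hL).1
      (intervalIntegral.intervalIntegrable_rpow' hr)
  · exact (ae_restrict_iff' measurableSet_Ioc).2 (ae_of_all _ fun l hl => rpow_nonneg hl.1.le _)

lemma setLIntegral_rpow_le_div_rpow_le {r Q v : ℝ} (hr : 2 < r) (hQ : 0 < Q) (hv : 0 < v) :
    ∫⁻ l in Ioi 0 ∩ {l | v ≤ (Q / l) ^ (r - 1)}, ENNReal.ofReal (l ^ (r - 3)) ≤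
      ENNReal.ofReal (Q ^ (r - 2) / (r - 2)) * ENNReal.ofReal v ^ (r.conjExponent - 2) := by
  have hr1 : 0 < r - 1 := by linarith
  set L := Q * v ^ (-(1 / (r - 1))) with hL
  have hL0 : 0 < L := by positivity
  have hsub : Ioi 0 ∩ {l | v ≤ (Q / l) ^ (r - 1)} ⊆ Ioc 0 L := by
    rintro l ⟨hl : 0 < l, h : v ≤ (Q / l) ^ (r - 1)⟩
    refine ⟨hl, ?_⟩
    have h1 : v ^ (1 / (r - 1)) ≤ Q / l := by
      have := rpow_le_rpow hv.le h (by positivity : 0 ≤ 1 / (r - 1))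
      rwa [← rpow_mul (by positivity), mul_one_div_cancel hr1.ne', rpow_one] at this
    rw [hL, rpow_neg hv.le, ← div_eq_mul_inv, le_div_iff₀ (by positivity)]
    rwa [le_div_iff₀ hl, mul_comm] at h1
  refine (lintegral_mono_set hsub).trans_eq ?_
  rw [lintegral_Ioc_rpow (by linarith) hL0.le, ENNReal.ofReal_rpow_of_pos hv,
    ← ENNReal.ofReal_mul (div_nonneg (by positivity) (by linarith)), hL,
    show r - 3 + 1 = r - 2 by ring, mul_rpow hQ.le (by positivity), ← rpow_mul hv.le,
    show -(1 / (r - 1)) * (r - 2) = r.conjExponent - 2 by rw [conjExponent]; field_simp; ring,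
    mul_div_right_comm]

variable {α β E F : Type*} [MeasurableSpace α] [MeasurableSpace β] {μ : Measure α} {ν : Measure β}
  [NormedAddCommGroup E] [NormedAddCommGroup F]

lemma setLIntegral_enorm_lt_norm_le {f : β → E} (hf : StronglyMeasurable f) {s p : ℝ} (hs : 0 < s)
    (hp : 1 ≤ p) :
    ∫⁻ y in {y | s < ‖f y‖}, ‖f y‖ₑ ∂ν ≤ ENNReal.ofReal (s ^ (1 - p)) * ∫⁻ y, ‖f y‖ₑ ^ p ∂ν := by
  have hA : MeasurableSet {y | s < ‖f y‖} := measurableSet_lt measurable_const hf.norm.measurable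
  rw [← lintegral_const_mul _ (hf.enorm.pow_const p)]
  refine (setLIntegral_mono' hA fun y (hy : s < ‖f y‖) => ?_).trans (setLIntegral_le_lintegral _ _)
  have hy0 : 0 < ‖f y‖ := hs.trans hy
  rw [← ofReal_norm, ENNReal.ofReal_rpow_of_pos hy0, ← ENNReal.ofReal_mul (by positivity)]
  refine ENNReal.ofReal_le_ofReal ?_
  calc ‖f y‖ = ‖f y‖ ^ (1 - p) * ‖f y‖ ^ p := by rw [← rpow_add hy0, sub_add_cancel, rpow_one]
    _ ≤ s ^ (1 - p) * ‖f y‖ ^ p := by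
        gcongr ?_ * _
        exact rpow_le_rpow_of_nonpos hs hy.le (by linarith)

-- The truncation height `(Q / l)^(r - 1)` is chosen so that the part of `f` above it contributes
-- at most `l / 2`.
lemma mul_setLIntegral_enorm_lt_norm_le {f : β → E} (hf : StronglyMeasurable f) {r B Q l : ℝ}
    (hr : 1 < r) (hB : 0 < B) (hQ : 0 < Q) (hl : 0 < l)
    (hfQ : ENNReal.ofReal (2 * B) * ∫⁻ y, ‖f y‖ₑ ^ r.conjExponent ∂ν ≤ ENNReal.ofReal Q) :
    ENNReal.ofReal B * ∫⁻ y in {y | (Q / l) ^ (r - 1) < ‖f y‖}, ‖f y‖ₑ ∂ν ≤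
      ENNReal.ofReal (l / 2) := by
  have hr1 : 0 < r - 1 := by linarith
  set p := r.conjExponent with hp
  have hp1 : 1 - p = -(1 / (r - 1)) := by rw [hp, conjExponent]; field_simp; ring
  have hp_one : 1 ≤ p := (HolderConjugate.conjExponent hr).symm.lt.le
  have hsp : ((Q / l) ^ (r - 1)) ^ (1 - p) = l / Q := by
    rw [hp1, ← rpow_mul (by positivity), mul_neg, mul_one_div_cancel hr1.ne', rpow_neg_one,
      inv_div]
  calc ENNReal.ofReal B * ∫⁻ y in {y | (Q / l) ^ (r - 1) < ‖f y‖}, ‖f y‖ₑ ∂ν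
      ≤ ENNReal.ofReal B * (ENNReal.ofReal (l / Q) * ∫⁻ y, ‖f y‖ₑ ^ p ∂ν) := by
        gcongr
        exact hsp ▸ setLIntegral_enorm_lt_norm_le hf (by positivity) hp_one
    _ = ENNReal.ofReal (l / (2 * Q)) * (ENNReal.ofReal (2 * B) * ∫⁻ y, ‖f y‖ₑ ^ p ∂ν) := by
        rw [← mul_assoc, ← mul_assoc, ← ENNReal.ofReal_mul hB.le,
          ← ENNReal.ofReal_mul (by positivity)]
        congr 2
        field_simp
    _ ≤ ENNReal.ofReal (l / (2 * Q)) * ENNReal.ofReal Q := by gcongr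
    _ = ENNReal.ofReal (l / 2) := by
        rw [← ENNReal.ofReal_mul (by positivity)]
        congr 1
        field_simp

lemma meas_lt_norm_le_of_le_add {u v w : α → F} {l : ℝ} (hl : 0 < l)
    (hw : AEStronglyMeasurable w μ) (hu : ∀ᵐ x ∂μ, u x = v x + w x)
    (hv : ∀ᵐ x ∂μ, ‖v x‖ₑ ≤ ENNReal.ofReal (l / 2)) :
    μ {x | l < ‖u x‖} ≤ ENNReal.ofReal (4 / l ^ 2) * ∫⁻ x, ‖w x‖ₑ ^ 2 ∂μ := by
  have hcheb := mul_meas_ge_le_lintegral₀ (hw.enorm.pow_const 2) (ENNReal.ofReal ((l / 2) ^ 2))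
  have hinv : ENNReal.ofReal (4 / l ^ 2) * ENNReal.ofReal ((l / 2) ^ 2) = 1 := by
    rw [← ENNReal.ofReal_mul (by positivity), ← ENNReal.ofReal_one]
    congr 1
    field_simp
    norm_num
  calc μ {x | l < ‖u x‖}
      ≤ μ {x | ENNReal.ofReal ((l / 2) ^ 2) ≤ ‖w x‖ₑ ^ 2} := by
        refine measure_mono_ae ?_
        filter_upwards [hu, hv] with x hux hvx (hx : l < ‖u x‖)
        rw [← ofReal_norm, ENNReal.ofReal_le_ofReal_iff (by positivity)] at hvx
        have hwx : l / 2 ≤ ‖w x‖ := by linarith [hux ▸ norm_add_le (v x) (w x)]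
        change ENNReal.ofReal ((l / 2) ^ 2) ≤ ‖w x‖ₑ ^ 2
        rw [← ofReal_norm, ← ENNReal.ofReal_pow (norm_nonneg _)]
        gcongr
    _ = ENNReal.ofReal (4 / l ^ 2) * (ENNReal.ofReal ((l / 2) ^ 2) *
          μ {x | ENNReal.ofReal ((l / 2) ^ 2) ≤ ‖w x‖ₑ ^ 2}) := by
        rw [← mul_assoc, hinv, one_mul]
    _ ≤ _ := by gcongr

lemma lintegral_rpow_mul_setLIntegral_enorm_sq_le [SFinite ν] {f : β → E}
    (hf : StronglyMeasurable f) {r Q : ℝ} (hr : 2 < r) (hQ : 0 < Q) :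
    ∫⁻ l in Ioi 0, ENNReal.ofReal (l ^ (r - 3)) *
        ∫⁻ y in {y | ‖f y‖ ≤ (Q / l) ^ (r - 1)}, ‖f y‖ₑ ^ 2 ∂ν ≤
      ENNReal.ofReal (Q ^ (r - 2) / (r - 2)) * ∫⁻ y, ‖f y‖ₑ ^ r.conjExponent ∂ν := by
  set S : Set (ℝ × β) := {q | ‖f q.2‖ ≤ (Q / q.1) ^ (r - 1)}
  have hS : MeasurableSet S :=
    measurableSet_le (hf.norm.measurable.comp measurable_snd) (by fun_prop)
  have hSl (l : ℝ) : MeasurableSet {y | ‖f y‖ ≤ (Q / l) ^ (r - 1)} :=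
    hS.preimage measurable_prodMk_left
  have hSy (y : β) : MeasurableSet {l | ‖f y‖ ≤ (Q / l) ^ (r - 1)} :=
    hS.preimage measurable_prodMk_right
  set g : ℝ → β → ℝ≥0∞ := fun l y => S.indicator
    (fun q => ENNReal.ofReal (q.1 ^ (r - 3)) * ‖f q.2‖ₑ ^ 2) (l, y)
  have hgm : Measurable (Function.uncurry g) :=
    Measurable.indicator (Measurable.mul (by fun_prop)
      ((hf.enorm.comp measurable_snd).pow_const 2)) hS
  have hrow (l : ℝ) : ENNReal.ofReal (l ^ (r - 3)) *
      ∫⁻ y in {y | ‖f y‖ ≤ (Q / l) ^ (r - 1)}, ‖f y‖ₑ ^ 2 ∂ν = ∫⁻ y, g l y ∂ν := by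
    rw [← lintegral_const_mul _ (hf.enorm.pow_const 2),
      ← lintegral_indicator (hSl l)]
    rfl
  have hcol (y : β) : ∫⁻ l in Ioi 0, g l y ≤
      ENNReal.ofReal (Q ^ (r - 2) / (r - 2)) * ‖f y‖ₑ ^ r.conjExponent := by
    have hy : ∫⁻ l in Ioi 0, g l y =
        (∫⁻ l in Ioi 0 ∩ {l | ‖f y‖ ≤ (Q / l) ^ (r - 1)}, ENNReal.ofReal (l ^ (r - 3))) *
          ‖f y‖ₑ ^ 2 := by
      rw [← lintegral_mul_const _ (by fun_prop), inter_comm,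
        ← Measure.restrict_restrict (hSy y), ← lintegral_indicator (hSy y)]
      rfl
    rw [hy]
    rcases (norm_nonneg (f y)).eq_or_lt with h0 | h0
    · simp [norm_eq_zero.1 h0.symm]
    · refine (mul_le_mul_left (setLIntegral_rpow_le_div_rpow_le hr hQ h0) _).trans_eq ?_
      rw [ofReal_norm, mul_assoc, ← ENNReal.rpow_two,
        ← ENNReal.rpow_add _ _ (by simpa using h0) (by simp), sub_add_cancel]
  simp only [hrow]
  rw [lintegral_lintegral_swap hgm.aemeasurable,
    ← lintegral_const_mul _ (hf.enorm.pow_const _)]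
  exact lintegral_mono hcol

lemma lintegral_enorm_rpow_le_of_meas_lt_le [SFinite ν] {u : α → F} {f : β → E}
    (hu : AEStronglyMeasurable u μ) (hf : StronglyMeasurable f) {r Q : ℝ} (hr : 2 < r) (hQ : 0 < Q)
    (hlevel : ∀ l, 0 < l → μ {x | l < ‖u x‖} ≤
      ENNReal.ofReal (4 / l ^ 2) * ∫⁻ y in {y | ‖f y‖ ≤ (Q / l) ^ (r - 1)}, ‖f y‖ₑ ^ 2 ∂ν) :
    ∫⁻ x, ‖u x‖ₑ ^ r ∂μ ≤
      ENNReal.ofReal (4 * r / (r - 2) * Q ^ (r - 2)) * ∫⁻ y, ‖f y‖ₑ ^ r.conjExponent ∂ν := by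
  have hr0 : 0 < r := by linarith
  have hfactor {l : ℝ} (hl : 0 < l) : ENNReal.ofReal (4 / l ^ 2) * ENNReal.ofReal (l ^ (r - 1)) =
      4 * ENNReal.ofReal (l ^ (r - 3)) := by
    rw [← ENNReal.ofReal_ofNat 4, ← ENNReal.ofReal_mul (by positivity),
      ← ENNReal.ofReal_mul (by positivity),
      show r - 1 = r - 3 + ((2 : ℕ) : ℝ) by push_cast; ring, rpow_add hl, rpow_natCast]
    field_simp
  calc ∫⁻ x, ‖u x‖ₑ ^ r ∂μ
      = ∫⁻ x, ENNReal.ofReal (‖u x‖ ^ r) ∂μ := by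
        simp only [← ofReal_norm, ENNReal.ofReal_rpow_of_nonneg (norm_nonneg _) hr0.le]
    _ = ENNReal.ofReal r * ∫⁻ l in Ioi 0, μ {x | l < ‖u x‖} * ENNReal.ofReal (l ^ (r - 1)) :=
        lintegral_rpow_eq_lintegral_meas_lt_mul μ (ae_of_all _ fun x => norm_nonneg _)
          hu.norm.aemeasurable hr0
    _ ≤ ENNReal.ofReal r * (4 * ∫⁻ l in Ioi 0, ENNReal.ofReal (l ^ (r - 3)) *
          ∫⁻ y in {y | ‖f y‖ ≤ (Q / l) ^ (r - 1)}, ‖f y‖ₑ ^ 2 ∂ν) := by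
        gcongr ENNReal.ofReal r * ?_
        rw [← lintegral_const_mul' _ _ (by simp)]
        refine setLIntegral_mono' measurableSet_Ioi fun l (hl : 0 < l) =>
          (mul_le_mul_left (hlevel l hl) _).trans_eq ?_
        rw [mul_right_comm, hfactor hl, mul_assoc]
    _ ≤ ENNReal.ofReal r * (4 * (ENNReal.ofReal (Q ^ (r - 2) / (r - 2)) *
          ∫⁻ y, ‖f y‖ₑ ^ r.conjExponent ∂ν)) := by
        gcongr
        exact lintegral_rpow_mul_setLIntegral_enorm_sq_le hf hr hQ
    _ = _ := by
        rw [← ENNReal.ofReal_ofNat 4, ← mul_assoc, ← mul_assoc,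
          ← ENNReal.ofReal_mul hr0.le, ← ENNReal.ofReal_mul (by positivity)]
        congr 2
        ring

/-- The hypotheses of the interpolation argument: `T A` plays the role of an operator, bounded by
`B` from `L¹` to `L^∞` and contractive on `L²`, applied to the truncation `1_A f` of a fixed
function. Indexing by sets makes the argument independent of a domain on which the operator is
defined. -/
structure IsTruncationFamily (T : Set β → α → F) (f : β → E) (B : ℝ) (μ : Measure α)
    (ν : Measure β) : Prop where
  aestronglyMeasurable : ∀ A, MeasurableSet A → AEStronglyMeasurable (T A) μ
  ae_eq_add_compl : ∀ A, MeasurableSet A → ∀ᵐ x ∂μ, T univ x = T A x + T Aᶜ x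
  enorm_le : ∀ A, MeasurableSet A →
    ∀ᵐ x ∂μ, ‖T A x‖ₑ ≤ ENNReal.ofReal B * ∫⁻ y in A, ‖f y‖ₑ ∂ν
  lintegral_sq_le : ∀ A, MeasurableSet A →
    ∫⁻ x, ‖T A x‖ₑ ^ 2 ∂μ ≤ ∫⁻ y in A, ‖f y‖ₑ ^ 2 ∂ν

lemma IsTruncationFamily.lintegral_rpow_le_of_le [SFinite ν] {T : Set β → α → F} {f : β → E}
    {B r Q : ℝ} (hT : IsTruncationFamily T f B μ ν) (hr : 2 < r) (hB : 0 < B) (hQ : 0 < Q)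
    (hf : StronglyMeasurable f)
    (hfQ : ENNReal.ofReal (2 * B) * ∫⁻ y, ‖f y‖ₑ ^ r.conjExponent ∂ν ≤ ENNReal.ofReal Q) :
    ∫⁻ x, ‖T univ x‖ₑ ^ r ∂μ ≤
      ENNReal.ofReal (4 * r / (r - 2) * Q ^ (r - 2)) * ∫⁻ y, ‖f y‖ₑ ^ r.conjExponent ∂ν := by
  refine lintegral_enorm_rpow_le_of_meas_lt_le (hT.aestronglyMeasurable _ .univ) hf hr hQ
    fun l hl => ?_
  set A : Set β := {y | (Q / l) ^ (r - 1) < ‖f y‖} with hA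
  have hAm : MeasurableSet A := measurableSet_lt measurable_const hf.norm.measurable
  have hAc : Aᶜ = {y | ‖f y‖ ≤ (Q / l) ^ (r - 1)} := by ext; simp [hA]
  have hlarge : ∀ᵐ x ∂μ, ‖T A x‖ₑ ≤ ENNReal.ofReal (l / 2) :=
    (hT.enorm_le A hAm).mono fun x hx =>
      hx.trans (mul_setLIntegral_enorm_lt_norm_le hf (by linarith) hB hQ hl hfQ)
  calc μ {x | l < ‖T univ x‖}
      ≤ ENNReal.ofReal (4 / l ^ 2) * ∫⁻ x, ‖T Aᶜ x‖ₑ ^ 2 ∂μ :=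
        meas_lt_norm_le_of_le_add hl (hT.aestronglyMeasurable _ hAm.compl)
          (hT.ae_eq_add_compl A hAm) hlarge
    _ ≤ _ := by
        rw [← hAc]
        gcongr
        exact hT.lintegral_sq_le _ hAm.compl

lemma IsTruncationFamily.lintegral_rpow_le [SFinite ν] {T : Set β → α → F} {f : β → E}
    {B r : ℝ} (hT : IsTruncationFamily T f B μ ν) (hr : 2 < r) (hB : 0 < B)
    (hf : StronglyMeasurable f) :
    ∫⁻ x, ‖T univ x‖ₑ ^ r ∂μ ≤ ENNReal.ofReal (4 * r / (r - 2) * (2 * B) ^ (r - 2)) *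
      (∫⁻ y, ‖f y‖ₑ ^ r.conjExponent ∂ν) ^ (r - 1) := by
  have : 0 < r - 2 := by linarith
  have hr1 : 0 < r - 1 := by linarith
  have hle {Q : ℝ} (hQ : 0 < Q) :=
    hT.lintegral_rpow_le_of_le hr hB hQ hf
  generalize ∫⁻ y, ‖f y‖ₑ ^ r.conjExponent ∂ν = P at hle ⊢
  rcases eq_or_ne P ⊤ with hPtop | hPtop
  · rw [hPtop, ENNReal.top_rpow_of_pos hr1, ENNReal.mul_top]
    · exact le_top
    · rw [Ne, ENNReal.ofReal_eq_zero, not_le]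
      positivity
  rcases eq_or_ne P 0 with hP0 | hP0
  · simpa [hP0, ENNReal.zero_rpow_of_pos hr1] using hle one_pos
  lift P to NNReal using hPtop
  have hP : 0 < (P : ℝ) := by exact_mod_cast pos_iff_ne_zero.2 hP0
  rw [← ENNReal.ofReal_coe_nnreal] at hle ⊢
  refine (hle (Q := 2 * B * P) (by positivity) ?_).trans_eq ?_
  · exact (ENNReal.ofReal_mul (by positivity)).ge
  · rw [ENNReal.ofReal_rpow_of_pos hP, ← ENNReal.ofReal_mul (by positivity),
      ← ENNReal.ofReal_mul (by positivity), mul_rpow (by positivity) hP.le,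
      show r - 1 = r - 2 + 1 by ring, rpow_add_one hP.ne']
    ring_nf

/-- A constant admissible in the real interpolation of an `L¹ → L^∞` bound with an `L²` contraction.
At `r = 2`, where nothing has to be interpolated, the second term of the maximum is `0`. -/
def interpolationConst (r : ℝ) : ℝ := max 1 ((4 * r / (r - 2) * 2 ^ (r - 2)) ^ (1 / r))

lemma one_le_interpolationConst (r : ℝ) : 1 ≤ interpolationConst r := le_max_left _ _

lemma eLpNorm_ofReal_eq {f : α → F} {r : ℝ} (hr : 0 < r) :
    eLpNorm f (ENNReal.ofReal r) μ = (∫⁻ x, ‖f x‖ₑ ^ r ∂μ) ^ (1 / r) := by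
  rw [eLpNorm_eq_lintegral_rpow_enorm_toReal (by simpa) ENNReal.ofReal_ne_top,
    ENNReal.toReal_ofReal hr.le]

theorem IsTruncationFamily.eLpNorm_le [SFinite ν] {T : Set β → α → F} {f : β → E} {B r : ℝ}
    (hT : IsTruncationFamily T f B μ ν) (hr : 2 ≤ r) (hB : 0 < B) (hf : StronglyMeasurable f) :
    eLpNorm (T univ) (ENNReal.ofReal r) μ ≤
      ENNReal.ofReal (interpolationConst r * B ^ (1 - 2 / r)) *
        eLpNorm f (ENNReal.ofReal r.conjExponent) ν := by
  have hr0 : 0 < r := by linarith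
  have hp0 : 0 < r.conjExponent := (HolderConjugate.conjExponent (by linarith)).symm.pos
  rw [eLpNorm_ofReal_eq hr0, eLpNorm_ofReal_eq hp0]
  rcases hr.eq_or_lt with rfl | hr2
  · rw [show conjExponent 2 = 2 by norm_num [conjExponent], div_self two_ne_zero, sub_self,
      rpow_zero, mul_one]
    refine le_mul_of_one_le_of_le (ENNReal.one_le_ofReal.2 (one_le_interpolationConst 2)) ?_
    simpa only [ENNReal.rpow_two, Measure.restrict_univ] using
      ENNReal.rpow_le_rpow (hT.lintegral_sq_le univ .univ) (by norm_num : (0 : ℝ) ≤ 1 / 2)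
  · have : 0 < r - 2 := by linarith
    have hr1 : 0 < r - 1 := by linarith
    refine (ENNReal.rpow_le_rpow (hT.lintegral_rpow_le hr2 hB hf)
      (by positivity : 0 ≤ 1 / r)).trans ?_
    rw [ENNReal.mul_rpow_of_nonneg _ _ (by positivity), ENNReal.ofReal_rpow_of_pos (by positivity),
      ← ENNReal.rpow_mul, show (r - 1) * (1 / r) = 1 / r.conjExponent by
        rw [conjExponent]; field_simp]
    gcongr
    rw [mul_rpow two_pos.le hB.le, ← mul_assoc, mul_rpow (by positivity) (by positivity),
      ← rpow_mul hB.le, show (r - 2) * (1 / r) = 1 - 2 / r by field_simp]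
    gcongr
    exact le_max_right _ _

end RealInterpolation

section WeightedInterpolation

variable {α β 𝕜 : Type*} [MeasurableSpace α] [MeasurableSpace β] [RCLike 𝕜] {μ : Measure α}
  {ν : Measure β}

/-- The measure `κ⁻² μ`. An operator with kernel `K` from `L^p(ν)` to `L^r(μ)` becomes, after
conjugation by weights `u` and `v`, one from `L^p(v⁻² ν)` to `L^r(u⁻² μ)`; on `L²` the
conjugation is unitary, while the kernel becomes `u K v`. -/
def invSqWeighted (κ : α → ℝ) (μ : Measure α) : Measure α :=
  μ.withDensity fun x => ENNReal.ofReal (κ x ^ 2)⁻¹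

lemma setLIntegral_invSqWeighted {κ : α → ℝ} (hκ : Measurable κ) (g : α → ℝ≥0∞) {A : Set α}
    (hA : MeasurableSet A) :
    ∫⁻ x in A, g x ∂invSqWeighted κ μ = ∫⁻ x in A, ENNReal.ofReal (κ x ^ 2)⁻¹ * g x ∂μ :=
  setLIntegral_withDensity_eq_setLIntegral_mul_non_measurable μ (by fun_prop) g hA
    (ae_of_all _ fun _ => ENNReal.ofReal_lt_top)

lemma lintegral_invSqWeighted {κ : α → ℝ} (hκ : Measurable κ) (g : α → ℝ≥0∞) :
    ∫⁻ x, g x ∂invSqWeighted κ μ = ∫⁻ x, ENNReal.ofReal (κ x ^ 2)⁻¹ * g x ∂μ := by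
  simpa only [Measure.restrict_univ] using setLIntegral_invSqWeighted (μ := μ) hκ g .univ

lemma ofReal_inv_sq_mul_enorm_mul_rpow {k s : ℝ} (hk : 0 < k) (hs : 0 < s) (z : 𝕜) :
    ENNReal.ofReal (k ^ 2)⁻¹ * ‖(k : 𝕜) * z‖ₑ ^ s = ‖z * ((k ^ (1 - 2 / s) : ℝ) : 𝕜)‖ₑ ^ s := by
  have henorm {c : ℝ} (hc : 0 < c) : ‖(c : 𝕜)‖ₑ = ENNReal.ofReal c := by
    rw [← ofReal_norm, RCLike.norm_ofReal, abs_of_pos hc]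
  rw [enorm_mul, enorm_mul, henorm hk, henorm (by positivity), ENNReal.mul_rpow_of_nonneg _ _ hs.le,
    ENNReal.mul_rpow_of_nonneg _ _ hs.le, ENNReal.ofReal_rpow_of_pos hk,
    ENNReal.ofReal_rpow_of_pos (by positivity), ← mul_assoc, ← ENNReal.ofReal_mul (by positivity),
    mul_comm, ← rpow_mul hk.le, sub_mul, one_mul, div_mul_cancel₀ _ hs.ne', rpow_sub hk, rpow_two,
    inv_mul_eq_div]

lemma eLpNorm_invSqWeighted {κ : α → ℝ} (hκ : Measurable κ) (hκ0 : ∀ᵐ x ∂μ, 0 < κ x) {s : ℝ}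
    (hs : 0 < s) (f : α → 𝕜) :
    eLpNorm (fun x => (κ x : 𝕜) * f x) (ENNReal.ofReal s) (invSqWeighted κ μ) =
      eLpNorm (fun x => f x * ((κ x ^ (1 - 2 / s) : ℝ) : 𝕜)) (ENNReal.ofReal s) μ := by
  rw [eLpNorm_ofReal_eq hs, eLpNorm_ofReal_eq hs, lintegral_invSqWeighted hκ]
  congr 1
  exact lintegral_congr_ae (hκ0.mono fun x hx => ofReal_inv_sq_mul_enorm_mul_rpow hx hs (f x))

lemma setLIntegral_enorm_mul_sq_invSqWeighted {κ : α → ℝ} (hκ : Measurable κ)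
    (hκ0 : ∀ᵐ x ∂μ, 0 < κ x) (f : α → 𝕜) {A : Set α} (hA : MeasurableSet A) :
    ∫⁻ x in A, ‖(κ x : 𝕜) * f x‖ₑ ^ 2 ∂invSqWeighted κ μ = ∫⁻ x in A, ‖f x‖ₑ ^ 2 ∂μ := by
  rw [setLIntegral_invSqWeighted hκ _ hA]
  refine lintegral_congr_ae ((ae_restrict_of_ae hκ0).mono fun x hx => ?_)
  simpa using ofReal_inv_sq_mul_enorm_mul_rpow hx two_pos (f x)

lemma enorm_mul_setIntegral_le {k : α → 𝕜} {f : α → 𝕜} {κ : α → ℝ} {c B : ℝ} (hκ : Measurable κ)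
    (hκ0 : ∀ᵐ y ∂μ, 0 < κ y) (hc : 0 ≤ c) (hB : 0 ≤ B)
    (hk : ∀ᵐ y ∂μ, c * ‖k y‖ * κ y ≤ B) {A : Set α} (hA : MeasurableSet A) :
    ‖(c : 𝕜) * ∫ y in A, k y * f y ∂μ‖ₑ ≤
      ENNReal.ofReal B * ∫⁻ y in A, ‖(κ y : 𝕜) * f y‖ₑ ∂invSqWeighted κ μ := by
  rw [setLIntegral_invSqWeighted hκ _ hA, ← lintegral_const_mul' _ _ ENNReal.ofReal_ne_top,
    ← integral_const_mul]
  refine (enorm_integral_le_lintegral_enorm _).trans (lintegral_mono_ae ?_)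
  filter_upwards [ae_restrict_of_ae hκ0, ae_restrict_of_ae hk] with y hy hky
  rw [← ofReal_norm, ← ofReal_norm, ← ENNReal.ofReal_mul (by positivity),
    ← ENNReal.ofReal_mul hB]
  refine ENNReal.ofReal_le_ofReal ?_
  rw [norm_mul, norm_mul, norm_mul, RCLike.norm_ofReal, RCLike.norm_ofReal, abs_of_nonneg hc,
    abs_of_pos hy]
  calc c * (‖k y‖ * ‖f y‖) = c * ‖k y‖ * κ y * ((κ y ^ 2)⁻¹ * (κ y * ‖f y‖)) := by field_simp
    _ ≤ B * ((κ y ^ 2)⁻¹ * (κ y * ‖f y‖)) := by gcongr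

lemma isTruncationFamily_setIntegral [SFinite ν] {K : α → β → 𝕜} {f : β → 𝕜} {u : α → ℝ}
    {v : β → ℝ} {B : ℝ} (hB : 0 ≤ B) (hK : Measurable (Function.uncurry K)) (hf : Measurable f)
    (hint : ∀ᵐ x ∂μ, Integrable (fun y => K x y * f y) ν)
    (hu : Measurable u) (hu0 : ∀ᵐ x ∂μ, 0 < u x) (hv : Measurable v) (hv0 : ∀ᵐ y ∂ν, 0 < v y)
    (hKB : ∀ᵐ x ∂μ, ∀ᵐ y ∂ν, u x * ‖K x y‖ * v y ≤ B)
    (hL2 : ∀ A, MeasurableSet A →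
      ∫⁻ x, ‖∫ y in A, K x y * f y ∂ν‖ₑ ^ 2 ∂μ ≤ ∫⁻ y in A, ‖f y‖ₑ ^ 2 ∂ν) :
    IsTruncationFamily (fun A x => (u x : 𝕜) * ∫ y in A, K x y * f y ∂ν)
      (fun y => (v y : 𝕜) * f y) B (invSqWeighted u μ) (invSqWeighted v ν) := by
  have hac : ae (invSqWeighted u μ) ≤ ae μ := (withDensity_absolutelyContinuous _ _).ae_le
  refine ⟨fun A _ => ?_, fun A hA => hac ?_, fun A hA => hac ?_, fun A hA => ?_⟩
  · exact ((RCLike.measurable_ofReal.comp hu).mul (StronglyMeasurable.integral_prod_right'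
      (hK.mul (hf.comp measurable_snd)).stronglyMeasurable).measurable).aestronglyMeasurable
  · exact hint.mono fun x hx => by
      rw [← mul_add, integral_add_compl hA hx, Measure.restrict_univ]
  · filter_upwards [hu0, hKB] with x hx hxB
    exact enorm_mul_setIntegral_le hv hv0 hx.le hB hxB hA
  · calc ∫⁻ x, ‖(u x : 𝕜) * ∫ y in A, K x y * f y ∂ν‖ₑ ^ 2 ∂invSqWeighted u μ
        = ∫⁻ x, ‖∫ y in A, K x y * f y ∂ν‖ₑ ^ 2 ∂μ := by
          simpa only [Measure.restrict_univ] using setLIntegral_enorm_mul_sq_invSqWeighted hu hu0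
            (fun x => ∫ y in A, K x y * f y ∂ν) .univ
      _ ≤ ∫⁻ y in A, ‖f y‖ₑ ^ 2 ∂ν := hL2 A hA
      _ = _ := (setLIntegral_enorm_mul_sq_invSqWeighted hv hv0 f hA).symm

theorem eLpNorm_integral_mul_rpow_le [SFinite ν] {K : α → β → 𝕜} {f : β → 𝕜} {u : α → ℝ}
    {v : β → ℝ} {B r : ℝ} (hr : 2 ≤ r) (hB : 0 < B) (hK : Measurable (Function.uncurry K))
    (hf : Measurable f) (hint : ∀ᵐ x ∂μ, Integrable (fun y => K x y * f y) ν)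
    (hu : Measurable u) (hu0 : ∀ᵐ x ∂μ, 0 < u x) (hv : Measurable v) (hv0 : ∀ᵐ y ∂ν, 0 < v y)
    (hKB : ∀ᵐ x ∂μ, ∀ᵐ y ∂ν, u x * ‖K x y‖ * v y ≤ B)
    (hL2 : ∀ A, MeasurableSet A →
      ∫⁻ x, ‖∫ y in A, K x y * f y ∂ν‖ₑ ^ 2 ∂μ ≤ ∫⁻ y in A, ‖f y‖ₑ ^ 2 ∂ν) :
    eLpNorm (fun x => (∫ y, K x y * f y ∂ν) * ((u x ^ (1 - 2 / r) : ℝ) : 𝕜))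
        (ENNReal.ofReal r) μ ≤
      ENNReal.ofReal (interpolationConst r * B ^ (1 - 2 / r)) *
        eLpNorm (fun y => f y * ((v y ^ (1 - 2 / r.conjExponent) : ℝ) : 𝕜))
          (ENNReal.ofReal r.conjExponent) ν := by
  have hfm : StronglyMeasurable fun y => (v y : 𝕜) * f y :=
    ((RCLike.measurable_ofReal.comp hv).mul hf).stronglyMeasurable
  have : SFinite (invSqWeighted v ν) := by unfold invSqWeighted; infer_instance
  have h := (isTruncationFamily_setIntegral hB.le hK hf hint hu hu0 hv hv0 hKB hL2).eLpNorm_le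
    hr hB hfm
  simp only [Measure.restrict_univ] at h
  rwa [eLpNorm_invSqWeighted hu hu0 (by linarith), eLpNorm_invSqWeighted hv hv0
    (HolderConjugate.conjExponent (by linarith)).symm.pos] at h

end WeightedInterpolation

section Series

open scoped Nat

/-- The regularized hypergeometric function `₀F₁(; b; w) / Γ(b) = ∑ₖ w^k / (k! Γ(b + k))` of real
arguments. It is the entire part of the Bessel functions: `J_ν(z) = (z/2)^ν hyp01 (ν+1) (-z²/4)`. -/
def hyp01 (b w : ℝ) : ℝ := ∑' k : ℕ, w ^ k / (k ! * Gamma (b + k))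

lemma Gamma_add_nat_pos {b : ℝ} (hb : 0 < b) (k : ℕ) : 0 < Gamma (b + k) :=
  Gamma_pos_of_pos (by positivity)

lemma exists_le_Gamma_add_nat {b : ℝ} (hb : 0 < b) :
    ∃ c, 0 < c ∧ ∀ k : ℕ, c ≤ Gamma (b + k) := by
  refine ⟨min (Gamma b) (min (Gamma (b + 1)) 1), ?_, ?_⟩
  · exact lt_min (Gamma_pos_of_pos hb) (lt_min (Gamma_pos_of_pos (by linarith)) one_pos)
  · rintro (_ | _ | k)
    · simp
    · simp
    · refine (min_le_right _ _).trans ((min_le_right _ _).trans ?_)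
      rw [← Gamma_two]
      have hle : 2 ≤ b + (k + 1 + 1 : ℕ) := by
        push_cast
        linarith [(Nat.cast_nonneg k : (0 : ℝ) ≤ k)]
      exact Gamma_strictMonoOn_Ici.monotoneOn self_mem_Ici hle hle

lemma summable_hyp01 {b : ℝ} (hb : 0 < b) (w : ℝ) :
    Summable fun k : ℕ => w ^ k / (k ! * Gamma (b + k)) := by
  obtain ⟨c, hc, h⟩ := exists_le_Gamma_add_nat hb
  refine Summable.of_norm_bounded ((Real.summable_pow_div_factorial |w|).mul_right c⁻¹)
    fun k => ?_
  have hG := Gamma_add_nat_pos hb k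
  rw [norm_div, norm_pow, norm_mul, Real.norm_of_nonneg hG.le, Real.norm_eq_abs,
    Real.norm_of_nonneg (by positivity : (0 : ℝ) ≤ k !), ← div_div, div_eq_mul_inv]
  gcongr
  exact h k

lemma hasSum_hyp01 {b : ℝ} (hb : 0 < b) (w : ℝ) :
    HasSum (fun k : ℕ => w ^ k / (k ! * Gamma (b + k))) (hyp01 b w) :=
  (summable_hyp01 hb w).hasSum

lemma hyp01_nonneg {b w : ℝ} (hb : 0 < b) (hw : 0 ≤ w) : 0 ≤ hyp01 b w :=
  tsum_nonneg fun k => by have := Gamma_add_nat_pos hb k; positivity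

lemma hyp01_zero {b : ℝ} : hyp01 b 0 = (Gamma b)⁻¹ := by
  rw [hyp01, tsum_eq_single 0 (fun k hk => by simp [hk])]
  simp

lemma succ_mul_div_factorial_mul_Gamma {b : ℝ} (k : ℕ) (x : ℝ) :
    ((k + 1 : ℕ) : ℝ) * x / ((k + 1)! * Gamma (b + (k + 1 : ℕ))) =
      x / (k ! * Gamma (b + 1 + k)) := by
  have h1 : ((k + 1 : ℕ) : ℝ) ≠ 0 := by positivity
  rw [Nat.factorial_succ, Nat.cast_mul, mul_assoc, mul_div_mul_left _ _ h1]
  push_cast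
  ring_nf

lemma hasSum_deriv_hyp01 {b : ℝ} (hb : 0 < b) (w : ℝ) :
    HasSum (fun k : ℕ => (k : ℝ) * w ^ (k - 1) / (k ! * Gamma (b + k))) (hyp01 (b + 1) w) := by
  rw [← hasSum_nat_add_iff' 1]
  simp only [succ_mul_div_factorial_mul_Gamma, Nat.add_sub_cancel]
  simpa using hasSum_hyp01 (by linarith : 0 < b + 1) w

lemma hasDerivAt_hyp01 {b : ℝ} (hb : 0 < b) (w : ℝ) :
    HasDerivAt (hyp01 b) (hyp01 (b + 1) w) w := by
  set R := |w| + 1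
  have hR : 0 < R := by positivity
  refine (hasDerivAt_tsum_of_isPreconnected (𝕜 := ℝ) (F := ℝ)
    (g := fun (k : ℕ) (w : ℝ) => w ^ k / (k ! * Gamma (b + k)))
    (g' := fun (k : ℕ) (w : ℝ) => (k : ℝ) * w ^ (k - 1) / (k ! * Gamma (b + k)))
    (t := Metric.ball 0 R) (y₀ := 0) (y := w) (hasSum_deriv_hyp01 hb R).summable Metric.isOpen_ball
    (convex_ball _ _).isPreconnected (fun k y _ => (hasDerivAt_pow k y).div_const _)
    (fun k y hy => ?_) (by simp [hR]) (summable_hyp01 hb 0) (by simp [R])).congr_deriv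
    (hasSum_deriv_hyp01 hb w).tsum_eq
  have hG := Gamma_add_nat_pos hb k
  have hy' : |y| ≤ R := (mem_ball_zero_iff.1 hy).le
  rw [norm_div, norm_mul, norm_mul, norm_pow, Real.norm_of_nonneg hG.le, Real.norm_eq_abs y,
    Real.norm_of_nonneg (by positivity : (0 : ℝ) ≤ k !),
    Real.norm_of_nonneg (by positivity : (0 : ℝ) ≤ k)]
  gcongr

lemma continuous_hyp01 {b : ℝ} (hb : 0 < b) : Continuous (hyp01 b) :=
  continuous_iff_continuousAt.2 fun w => (hasDerivAt_hyp01 hb w).continuousAt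

lemma mul_hyp01_add_two_add_mul_hyp01_add_one {b : ℝ} (hb : 0 < b) (w : ℝ) :
    w * hyp01 (b + 2) w + b * hyp01 (b + 1) w = hyp01 b w := by
  have hw : HasSum (fun k : ℕ => (k : ℝ) * w ^ k / (k ! * Gamma (b + 1 + k)))
      (w * hyp01 (b + 2) w) := by
    have h := (hasSum_deriv_hyp01 (by linarith : 0 < b + 1) w).mul_left w
    rw [add_assoc, one_add_one_eq_two] at h
    refine h.congr_fun fun k => ?_
    rcases k with _ | k
    · simp
    · rw [Nat.add_sub_cancel, pow_succ]; ring
  refine (hw.add ((hasSum_hyp01 (by linarith : 0 < b + 1) w).mul_left b)).unique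
    ((hasSum_hyp01 hb w).congr_fun fun k => ?_)
  have hG := (Gamma_add_nat_pos hb k).ne'
  rw [add_right_comm, Gamma_add_one (by positivity : b + k ≠ 0)]
  field_simp
  ring

lemma hasDerivAt_hyp01_neg {b : ℝ} (hb : 0 < b) (s : ℝ) :
    HasDerivAt (fun s => hyp01 b (-s)) (-hyp01 (b + 1) (-s)) s :=
  ((hasDerivAt_hyp01 hb (-s)).comp s (hasDerivAt_neg s)).congr_deriv (by ring)

lemma hasDerivAt_hyp01_add_one_neg {b s : ℝ} (hb : 0 < b) (hs : s ≠ 0) :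
    HasDerivAt (fun s => hyp01 (b + 1) (-s)) ((hyp01 b (-s) - b * hyp01 (b + 1) (-s)) / s) s := by
  refine (hasDerivAt_hyp01_neg (by linarith : 0 < b + 1) s).congr_deriv ?_
  rw [← mul_hyp01_add_two_add_mul_hyp01_add_one hb (-s), add_assoc, one_add_one_eq_two]
  field_simp
  ring

/-- With `G s = hyp01 b (-s)`, the energy `G² + s G'²` is nonincreasing. -/
lemma abs_hyp01_neg_le {b s : ℝ} (hb : 1 / 2 ≤ b) (hs : 0 ≤ s) :
    |hyp01 b (-s)| ≤ (Gamma b)⁻¹ := by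
  have hb0 : 0 < b := by linarith
  set E : ℝ → ℝ := fun s => hyp01 b (-s) ^ 2 + s * hyp01 (b + 1) (-s) ^ 2
  have hE (s : ℝ) : HasDerivAt E ((1 - 2 * b) * hyp01 (b + 1) (-s) ^ 2) s := by
    have h := ((hasDerivAt_hyp01_neg hb0 s).fun_pow 2).add ((hasDerivAt_id' s).fun_mul
      ((hasDerivAt_hyp01_neg (by linarith : 0 < b + 1) s).fun_pow 2))
    rw [add_assoc b, one_add_one_eq_two] at h
    refine h.congr_deriv ?_
    rw [← mul_hyp01_add_two_add_mul_hyp01_add_one hb0 (-s)]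
    push_cast
    ring
  have hanti : Antitone E := antitone_of_deriv_nonpos (fun s => (hE s).differentiableAt) fun s => by
    rw [(hE s).deriv]
    exact mul_nonpos_of_nonpos_of_nonneg (by linarith) (sq_nonneg _)
  have hG : 0 < (Gamma b)⁻¹ := inv_pos.2 (Gamma_pos_of_pos hb0)
  refine abs_le_of_sq_le_sq ?_ hG.le
  calc hyp01 b (-s) ^ 2 ≤ E s := le_add_of_nonneg_right (by positivity)
    _ ≤ E 0 := hanti hs
    _ = (Gamma b)⁻¹ ^ 2 := by simp [E, hyp01_zero]

/-- The Sonin energy of `G s = hyp01 b (-s)`: Sonin's function of the Bessel equation in Liouville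
normal form, whose potential in the variable `z = 2√s` is `1 - m / z²` with
`m = (b - 1/2) (b - 3/2)`. Here `(b - 1/2) G + 2 s G'` is a multiple of the derivative of the
normalized solution `s ^ ((b - 1/2) / 2) G`. -/
def soninEnergy (b s : ℝ) : ℝ :=
  s ^ (b - 1 / 2) * (hyp01 b (-s) ^ 2 +
    ((b - 1 / 2) * hyp01 b (-s) - 2 * s * hyp01 (b + 1) (-s)) ^ 2 /
      (4 * s - (b - 1 / 2) * (b - 3 / 2)))

lemma hasDerivAt_soninEnergy {b s : ℝ} (hb : 0 < b) (hs : 0 < s)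
    (hm : 4 * s - (b - 1 / 2) * (b - 3 / 2) ≠ 0) :
    HasDerivAt (soninEnergy b)
      (-((b - 1 / 2) * (b - 3 / 2)) * s ^ (b - 1 / 2) *
        ((b - 1 / 2) * hyp01 b (-s) - 2 * s * hyp01 (b + 1) (-s)) ^ 2 /
          (s * (4 * s - (b - 1 / 2) * (b - 3 / 2)) ^ 2)) s := by
  have hG := hasDerivAt_hyp01_neg hb s
  have hP := (hG.const_mul (b - 1 / 2)).fun_sub (((hasDerivAt_id' s).const_mul 2).fun_mul
    (hasDerivAt_hyp01_add_one_neg hb hs.ne'))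
  have hD := ((hasDerivAt_id' s).const_mul 4).sub_const ((b - 1 / 2) * (b - 3 / 2))
  refine ((hasDerivAt_rpow_const (p := b - 1 / 2) (Or.inl hs.ne')).fun_mul
    ((hG.fun_pow 2).fun_add ((hP.fun_pow 2).fun_div hD hm))).congr_deriv ?_
  rw [rpow_sub_one hs.ne']
  generalize hDdef : 4 * s - (b - 1 / 2) * (b - 3 / 2) = D at hm ⊢
  field_simp
  rw [← hDdef]
  ring

lemma soninEnergy_antitoneOn {b : ℝ} (hb : 0 < b) (hb' : b < 1 / 2) :
    AntitoneOn (soninEnergy b) (Ici 1) := by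
  have hm : 0 ≤ (b - 1 / 2) * (b - 3 / 2) := by nlinarith
  have hderiv {s : ℝ} (hs : 1 ≤ s) :=
    hasDerivAt_soninEnergy hb (by linarith : 0 < s) (by nlinarith)
  refine antitoneOn_of_deriv_nonpos (convex_Ici 1)
    (fun s hs => (hderiv hs).continuousAt.continuousWithinAt) ?_ ?_ <;>
    rw [interior_Ici] <;> intro s hs
  · exact (hderiv (le_of_lt hs)).differentiableAt.differentiableWithinAt
  · have hs0 : 0 < s := one_pos.trans hs
    rw [(hderiv (le_of_lt hs)).deriv, neg_mul, neg_mul, neg_div]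
    exact neg_nonpos.2 (by positivity)

lemma sq_hyp01_neg_le {b s : ℝ} (hb : 0 < b) (hb' : b < 1 / 2) (hs : 1 ≤ s) :
    hyp01 b (-s) ^ 2 ≤ soninEnergy b 1 * s ^ (1 / 2 - b) := by
  have hs0 : 0 < s := by linarith
  have hD : 0 < 4 * s - (b - 1 / 2) * (b - 3 / 2) := by nlinarith
  rw [← neg_sub, rpow_neg hs0.le, ← div_eq_mul_inv, le_div_iff₀' (by positivity)]
  refine le_trans ?_ (soninEnergy_antitoneOn hb hb' (mem_Ici.2 le_rfl) hs hs)
  exact mul_le_mul_of_nonneg_left (le_add_of_nonneg_right (by positivity)) (by positivity)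

lemma exists_abs_hyp01_neg_le {b : ℝ} (hb : 0 < b) (hb' : b < 1 / 2) :
    ∃ C, 0 < C ∧ ∀ s, 0 ≤ s → |hyp01 b (-s)| ≤ C * (1 + s ^ ((1 / 2 - b) / 2)) := by
  obtain ⟨D, hD⟩ := (isCompact_Icc (a := (0 : ℝ)) (b := 1)).exists_bound_of_continuousOn
    ((continuous_hyp01 hb).comp continuous_neg).continuousOn
  have hC : 0 < max D √(soninEnergy b 1) + 1 := by positivity
  refine ⟨max D √(soninEnergy b 1) + 1, hC, fun s hs => ?_⟩
  have hp : 0 ≤ s ^ ((1 / 2 - b) / 2) := by positivity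
  rcases le_total s 1 with h1 | h1
  · have : |hyp01 b (-s)| ≤ D := hD s ⟨hs, h1⟩
    nlinarith [le_max_left D √(soninEnergy b 1), mul_nonneg hC.le hp]
  · have : |hyp01 b (-s)| ≤ √(soninEnergy b 1) * s ^ ((1 / 2 - b) / 2) := by
      refine (abs_le_sqrt (sq_hyp01_neg_le hb hb' h1)).trans_eq ?_
      rw [sqrt_mul' _ (by positivity), sqrt_eq_rpow (s ^ _), ← rpow_mul hs, mul_one_div]
    nlinarith [mul_le_mul_of_nonneg_right (le_max_right D √(soninEnergy b 1)) hp]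

end Series

section Weber

open scoped Nat

lemma sum_choose_succ_div_factorial_mul_Gamma (j k : ℕ) (b : ℝ) :
    ∑ m ∈ Finset.range (k + 1 + 1), ((j + 1).choose m : ℝ) / ((k + 1 - m)! * Gamma (b + m)) =
      ∑ m ∈ Finset.range (k + 1 + 1), (j.choose m : ℝ) / ((k + 1 - m)! * Gamma (b + m)) +
      ∑ m ∈ Finset.range (k + 1), (j.choose m : ℝ) / ((k - m)! * Gamma (b + 1 + m)) := by
  rw [Finset.sum_range_succ', Finset.sum_range_succ' _ (k + 1), add_right_comm,
    ← Finset.sum_add_distrib]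
  congr 1
  · refine Finset.sum_congr rfl fun m _ => ?_
    rw [Nat.choose_succ_succ, Nat.add_sub_add_right,
      show b + 1 + (m : ℝ) = b + (m + 1 : ℕ) by push_cast; ring]
    push_cast
    ring
  · simp only [Nat.choose_zero_right]

/-- A form of the Chu–Vandermonde identity. -/
lemma sum_choose_div_factorial_mul_Gamma (j k : ℕ) {b : ℝ} (hb : 0 < b) :
    ∑ m ∈ Finset.range (k + 1), (j.choose m : ℝ) / ((k - m)! * Gamma (b + m)) =
      Gamma (b + j + k) / (k ! * Gamma (b + j) * Gamma (b + k)) := by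
  induction j generalizing k b with
  | zero =>
    have hG := (Gamma_pos_of_pos hb).ne'
    have hGk := (Gamma_add_nat_pos hb k).ne'
    rw [Finset.sum_range_succ', Finset.sum_eq_zero fun m _ => by simp]
    simp only [Nat.choose_zero_right, Nat.cast_one, CharP.cast_eq_zero, add_zero, tsub_zero,
      zero_add]
    field_simp
  | succ j ih =>
    have hj : b + j ≠ 0 := by positivity
    have hGj := (Gamma_add_nat_pos hb j).ne'
    cases k with
    | zero =>
      have hG := (Gamma_pos_of_pos hb).ne'
      have hGj' := (Gamma_add_nat_pos hb (j + 1)).ne'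
      simp only [zero_add, Finset.range_one, Finset.sum_singleton, Nat.choose_zero_right,
        Nat.cast_one, Nat.factorial_zero, Nat.cast_zero, add_zero, tsub_self]
      field_simp
    | succ k =>
      have hGk := (Gamma_add_nat_pos hb (k + 1)).ne'
      have hjk : b + j + (k + 1 : ℕ) ≠ 0 := by positivity
      rw [sum_choose_succ_div_factorial_mul_Gamma, ih (k + 1) hb, ih k (by linarith : 0 < b + 1),
        show b + (j + 1 : ℕ) = b + j + 1 by push_cast; ring,
        show b + (j : ℝ) + 1 + (k + 1 : ℕ) = b + j + (k + 1 : ℕ) + 1 by push_cast; ring,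
        show b + 1 + (j : ℝ) = b + j + 1 by ring,
        show b + (j : ℝ) + 1 + (k : ℝ) = b + j + (k + 1 : ℕ) by push_cast; ring,
        show b + 1 + (k : ℝ) = b + (k + 1 : ℕ) by push_cast; ring,
        Gamma_add_one hj, Gamma_add_one hjk, Nat.factorial_succ]
      push_cast at hGk ⊢
      field_simp

/-- The term of index `(j - m, k - m, m)` of the product of the series of `exp u`, `exp v` and
`hyp01 b (u * v)`: the part of that product carrying `u ^ j * v ^ k`. -/
def weberTerm (b u v : ℝ) (x : (ℕ × ℕ) × ℕ) : ℝ :=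
  if x.2 ≤ x.1.1 ∧ x.2 ≤ x.1.2 then
    u ^ x.1.1 * v ^ x.1.2 / ((x.1.1 - x.2)! * (x.1.2 - x.2)! * x.2 ! * Gamma (b + x.2))
  else 0

lemma hasSum_weberTerm {b : ℝ} (hb : 0 < b) (u v : ℝ) :
    HasSum (weberTerm b u v) (exp u * exp v * hyp01 b (u * v)) := by
  have hexp (u : ℝ) : HasSum (fun p : ℕ => u ^ p / p !) (exp u) := by
    rw [Real.exp_eq_exp_ℝ]
    exact NormedSpace.expSeries_div_hasSum_exp u
  have hmul {ι κ : Type} {f : ι → ℝ} {g : κ → ℝ} {s t : ℝ} (hf : HasSum f s) (hg : HasSum g t) :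
      HasSum (fun x : ι × κ => f x.1 * g x.2) (s * t) :=
    hf.mul hg (summable_mul_of_summable_norm hf.summable.norm hg.summable.norm)
  let shift : (ℕ × ℕ) × ℕ → (ℕ × ℕ) × ℕ := fun x => ((x.1.1 + x.2, x.1.2 + x.2), x.2)
  have hshift : shift.Injective := by
    rintro ⟨⟨p, q⟩, m⟩ ⟨⟨p', q'⟩, m'⟩ h
    simp only [shift, Prod.mk.injEq] at h ⊢
    omega
  rw [← hshift.hasSum_iff]
  · refine (hmul (hmul (hexp u) (hexp v)) (hasSum_hyp01 hb (u * v))).congr_fun fun x => ?_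
    have := (Gamma_add_nat_pos hb x.2).ne'
    simp only [weberTerm, shift, Function.comp_apply, le_add_iff_nonneg_left, zero_le, and_self,
      if_true, Nat.add_sub_cancel]
    field_simp
    ring
  · rintro ⟨⟨j, k⟩, m⟩ hx
    refine if_neg fun h => hx ⟨((j - m, k - m), m), ?_⟩
    simp only [shift, Nat.sub_add_cancel h.1, Nat.sub_add_cancel h.2]

lemma hasSum_weberTerm_fiber {b : ℝ} (hb : 0 < b) (u v : ℝ) (j k : ℕ) :
    HasSum (fun m => weberTerm b u v ((j, k), m))
      (u ^ j * v ^ k * Gamma (b + j + k) / (j ! * k ! * Gamma (b + j) * Gamma (b + k))) := by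
  have hval : u ^ j * v ^ k * Gamma (b + j + k) / (j ! * k ! * Gamma (b + j) * Gamma (b + k)) =
      ∑ m ∈ Finset.range (k + 1), weberTerm b u v ((j, k), m) := by
    rw [mul_assoc (j ! : ℝ), mul_assoc (j ! : ℝ), mul_div_mul_comm,
      ← sum_choose_div_factorial_mul_Gamma j k hb, Finset.mul_sum]
    refine Finset.sum_congr rfl fun m hm => ?_
    have hmk : m ≤ k := Finset.mem_range_succ_iff.1 hm
    have hG := (Gamma_add_nat_pos hb m).ne'
    by_cases hmj : m ≤ j
    · simp only [weberTerm, hmj, hmk, and_self, if_true]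
      rw [Nat.cast_choose ℝ hmj]
      field_simp
    · simp [weberTerm, hmj, Nat.choose_eq_zero_of_lt (not_le.1 hmj)]
  rw [hval]
  refine hasSum_sum_of_ne_finset_zero fun m hm => if_neg fun h => hm ?_
  exact Finset.mem_range_succ_iff.2 h.2

/-- The double series behind Weber's second exponential integral. -/
lemma hasSum_weber {b : ℝ} (hb : 0 < b) (u v : ℝ) :
    HasSum (fun jk : ℕ × ℕ => u ^ jk.1 * v ^ jk.2 * Gamma (b + jk.1 + jk.2) /
      (jk.1 ! * jk.2 ! * Gamma (b + jk.1) * Gamma (b + jk.2)))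
      (exp u * exp v * hyp01 b (u * v)) :=
  (hasSum_weberTerm hb u v).prod_fiberwise fun jk => hasSum_weberTerm_fiber hb u v jk.1 jk.2

end Weber

section Omega

instance (a : ℝ) : SFinite (omega a) := by unfold omega; infer_instance

lemma measurable_rpow_weight (a : ℝ) : Measurable fun x : ℝ => ENNReal.ofReal (x ^ a) := by
  fun_prop

lemma ae_omega {a : ℝ} {p : ℝ → Prop} (h : ∀ x, 0 < x → p x) : ∀ᵐ x ∂omega a, p x :=
  (withDensity_absolutelyContinuous _ _).ae_le (ae_restrict_of_forall_mem measurableSet_Ioi h)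

lemma integral_omega (a : ℝ) (f : ℝ → ℝ) :
    ∫ x, f x ∂omega a = ∫ x in Ioi 0, f x * x ^ a := by
  rw [omega, integral_withDensity_eq_integral_toReal_smul (measurable_rpow_weight a)
    (ae_of_all _ fun x => ENNReal.ofReal_lt_top)]
  refine setIntegral_congr_fun measurableSet_Ioi fun x (hx : 0 < x) => ?_
  rw [ENNReal.toReal_ofReal (by positivity), smul_eq_mul, mul_comm]

lemma integrable_omega_iff (a : ℝ) (f : ℝ → ℝ) :
    Integrable f (omega a) ↔ IntegrableOn (fun x => f x * x ^ a) (Ioi 0) := by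
  rw [omega, integrable_withDensity_iff (measurable_rpow_weight a)
    (ae_of_all _ fun x => ENNReal.ofReal_lt_top)]
  refine integrableOn_congr_fun (fun x (hx : 0 < x) => ?_) measurableSet_Ioi
  rw [ENNReal.toReal_ofReal (by positivity)]

lemma pow_mul_exp_mul_rpow {x : ℝ} (hx : 0 < x) (a ε : ℝ) (k : ℕ) :
    x ^ (2 * k) * exp (-ε * x ^ 2) * x ^ a = x ^ (2 * k + a) * exp (-ε * x ^ 2) := by
  rw [rpow_add hx, show (2 * k : ℝ) = (2 * k : ℕ) by push_cast; rfl, rpow_natCast]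
  ring

lemma integrable_pow_mul_exp_omega {a ε : ℝ} (ha : -1 < a) (hε : 0 < ε) (k : ℕ) :
    Integrable (fun x => x ^ (2 * k) * exp (-ε * x ^ 2)) (omega a) := by
  rw [integrable_omega_iff, integrableOn_congr_fun
    (fun x hx => pow_mul_exp_mul_rpow (mem_Ioi.1 hx) a ε k) measurableSet_Ioi]
  exact integrableOn_rpow_mul_exp_neg_mul_sq hε (by linarith [(Nat.cast_nonneg k : (0 : ℝ) ≤ k)])

lemma integral_pow_mul_exp_omega {a ε : ℝ} (ha : -1 < a) (hε : 0 < ε) (k : ℕ) :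
    ∫ x, x ^ (2 * k) * exp (-ε * x ^ 2) ∂omega a =
      1 / 2 * ε ^ (-((a + 1) / 2)) * (ε⁻¹ ^ k * Gamma ((a + 1) / 2 + k)) := by
  have : (0 : ℝ) ≤ k := Nat.cast_nonneg k
  have h := integral_rpow_mul_exp_neg_mul_rpow (p := 2) (q := 2 * k + a) two_pos (by linarith) hε
  simp only [rpow_two] at h
  rw [integral_omega, setIntegral_congr_fun measurableSet_Ioi
    (fun x hx => pow_mul_exp_mul_rpow (mem_Ioi.1 hx) a ε k), h,
    show (2 * k + a + 1) / 2 = (a + 1) / 2 + k by ring,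
    show -(2 * k + a + 1) / 2 = -((a + 1) / 2) + -k by ring, rpow_add hε, rpow_neg hε.le k,
    rpow_natCast, inv_pow]
  ring

end Omega

section Weber

open scoped Nat

lemma integral_weber_term {a ε : ℝ} (ha : -1 < a) (hε : 0 < ε) (u v : ℝ) (jk : ℕ × ℕ) :
    ∫ x, u ^ jk.1 / (jk.1 ! * Gamma ((a + 1) / 2 + jk.1)) *
        (v ^ jk.2 / (jk.2 ! * Gamma ((a + 1) / 2 + jk.2))) *
        (x ^ (2 * (jk.1 + jk.2)) * exp (-ε * x ^ 2)) ∂omega a =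
      1 / 2 * ε ^ (-((a + 1) / 2)) *
        ((u / ε) ^ jk.1 * (v / ε) ^ jk.2 * Gamma ((a + 1) / 2 + jk.1 + jk.2) /
          (jk.1 ! * jk.2 ! * Gamma ((a + 1) / 2 + jk.1) * Gamma ((a + 1) / 2 + jk.2))) := by
  rw [integral_const_mul, integral_pow_mul_exp_omega ha hε, Nat.cast_add, ← add_assoc, pow_add,
    div_eq_mul_inv u, div_eq_mul_inv v, mul_pow, mul_pow]
  ring

lemma hasSum_exp_mul_hyp01_mul_hyp01 {b : ℝ} (hb : 0 < b) (ε u v x : ℝ) :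
    HasSum (fun jk : ℕ × ℕ => u ^ jk.1 / (jk.1 ! * Gamma (b + jk.1)) *
        (v ^ jk.2 / (jk.2 ! * Gamma (b + jk.2))) * (x ^ (2 * (jk.1 + jk.2)) * exp (-ε * x ^ 2)))
      (exp (-ε * x ^ 2) * (hyp01 b (u * x ^ 2) * hyp01 b (v * x ^ 2))) := by
  have hu := hasSum_hyp01 hb (u * x ^ 2)
  have hv := hasSum_hyp01 hb (v * x ^ 2)
  refine ((hu.mul hv (summable_mul_of_summable_norm hu.summable.norm hv.summable.norm)).mul_left
    (exp (-ε * x ^ 2))).congr_fun fun jk => ?_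
  rw [mul_pow, mul_pow, ← pow_mul, ← pow_mul, mul_add, pow_add]
  ring

/-- Weber's second exponential integral. -/
lemma integral_weber {a ε : ℝ} (ha : -1 < a) (hε : 0 < ε) (u v : ℝ) :
    ∫ x, exp (-ε * x ^ 2) * (hyp01 ((a + 1) / 2) (u * x ^ 2) * hyp01 ((a + 1) / 2) (v * x ^ 2))
        ∂omega a =
      1 / 2 * ε ^ (-((a + 1) / 2)) *
        (exp (u / ε) * exp (v / ε) * hyp01 ((a + 1) / 2) (u / ε * (v / ε))) := by
  have hb : 0 < (a + 1) / 2 := by linarith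
  have hsum := hasSum_integral_of_summable_integral_norm (μ := omega a)
    (fun jk : ℕ × ℕ => (integrable_pow_mul_exp_omega ha hε (jk.1 + jk.2)).const_mul
      (u ^ jk.1 / (jk.1 ! * Gamma ((a + 1) / 2 + jk.1)) *
        (v ^ jk.2 / (jk.2 ! * Gamma ((a + 1) / 2 + jk.2))))) ?_
  · simp only [integral_weber_term ha hε,
      (hasSum_exp_mul_hyp01_mul_hyp01 hb ε u v _).tsum_eq] at hsum
    exact hsum.unique ((hasSum_weber hb (u / ε) (v / ε)).mul_left _)
  · refine ((hasSum_weber hb (|u| / ε) (|v| / ε)).mul_left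
      (1 / 2 * ε ^ (-((a + 1) / 2)))).summable.congr fun jk => ?_
    rw [← integral_weber_term ha hε]
    refine integral_congr_ae (ae_of_all _ fun x => ?_)
    have hG (k : ℕ) : |Gamma ((a + 1) / 2 + k)| = Gamma ((a + 1) / 2 + k) :=
      abs_of_pos (Gamma_add_nat_pos hb k)
    simp only [norm_mul, norm_div, norm_pow, Real.norm_eq_abs, abs_exp, hG, Nat.abs_cast, pow_mul,
      sq_abs]

/-- Weber's first exponential integral: the case `v = 0` of the second one. -/
lemma integral_exp_mul_hyp01 {a ε : ℝ} (ha : -1 < a) (hε : 0 < ε) (u : ℝ) :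
    ∫ x, exp (-ε * x ^ 2) * hyp01 ((a + 1) / 2) (u * x ^ 2) ∂omega a =
      1 / 2 * ε ^ (-((a + 1) / 2)) * exp (u / ε) := by
  have h := integral_weber ha hε u 0
  simp only [zero_mul, zero_div, mul_zero, exp_zero, mul_one, hyp01_zero, ← mul_assoc] at h
  rw [integral_mul_const] at h
  exact mul_right_cancel₀ (inv_ne_zero (Gamma_pos_of_pos (by linarith)).ne') h

end Weber

section HeatKernel

/-- The heat kernel `e^{sL}(y, z)` of the Bessel operator `L = ∂² + (a / x) ∂` on `(0, ∞)` with
respect to `omega a`, at time `s = 1 / (4δ)`. It is the `TT*` kernel of the Hankel transform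
regularized by a Gaussian. -/
def heatKernel (a δ y z : ℝ) : ℝ :=
  2 * δ ^ ((a + 1) / 2) * (exp (-δ * y ^ 2) * exp (-δ * z ^ 2) *
    hyp01 ((a + 1) / 2) (δ * y ^ 2 * (δ * z ^ 2)))

lemma heatKernel_nonneg {a δ : ℝ} (ha : -1 < a) (hδ : 0 < δ) (y z : ℝ) :
    0 ≤ heatKernel a δ y z := by
  have := hyp01_nonneg (by linarith : 0 < (a + 1) / 2)
    (by positivity : 0 ≤ δ * y ^ 2 * (δ * z ^ 2))
  unfold heatKernel
  positivity

lemma integral_heatKernel {a δ : ℝ} (ha : -1 < a) (hδ : 0 < δ) (y : ℝ) :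
    ∫ z, heatKernel a δ y z ∂omega a = 1 := by
  have hpow : δ ^ ((a + 1) / 2) ≠ 0 := by positivity
  calc ∫ z, heatKernel a δ y z ∂omega a
      = ∫ z, 2 * δ ^ ((a + 1) / 2) * exp (-δ * y ^ 2) *
          (exp (-δ * z ^ 2) * hyp01 ((a + 1) / 2) (δ ^ 2 * y ^ 2 * z ^ 2)) ∂omega a := by
        refine integral_congr_ae (ae_of_all _ fun z => ?_)
        simp only [heatKernel]
        rw [show δ * y ^ 2 * (δ * z ^ 2) = δ ^ 2 * y ^ 2 * z ^ 2 by ring]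
        ring
    _ = exp (-δ * y ^ 2) * exp (δ * y ^ 2) := by
        rw [integral_const_mul, integral_exp_mul_hyp01 ha hδ, rpow_neg hδ.le,
          show δ ^ 2 * y ^ 2 / δ = δ * y ^ 2 by field_simp]
        field_simp
    _ = 1 := by rw [← exp_add, neg_mul, neg_add_cancel, exp_zero]

lemma lintegral_heatKernel {a δ : ℝ} (ha : -1 < a) (hδ : 0 < δ) (y : ℝ) :
    ∫⁻ z, ENNReal.ofReal (heatKernel a δ y z) ∂omega a = 1 := by
  have h := integral_heatKernel ha hδ y
  rw [← ofReal_integral_eq_lintegral_ofReal (.of_integral_ne_zero (h ▸ one_ne_zero))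
    (ae_of_all _ (heatKernel_nonneg ha hδ y)), h, ENNReal.ofReal_one]

end HeatKernel

section Hankel

open scoped ComplexConjugate

/-- The kernel `τ^(-b) z^(1-b) J_(b-1)(z)`, `z = x y / τ`, `b = (a + 1) / 2`, of the Hankel
transform of `L²(omega a)` dilated by `τ`, in a form that makes sense for all real `x` and `y`. -/
def hankelKernel (a τ x y : ℝ) : ℝ :=
  2 ^ (1 - (a + 1) / 2) * τ ^ (-((a + 1) / 2)) * hyp01 ((a + 1) / 2) (-(x * y / (2 * τ)) ^ 2)

/-- The Hankel transform on `omega a`, dilated by `τ`. -/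
def hankelTransform (a τ : ℝ) (f : ℝ → ℂ) (x : ℝ) : ℂ := ∫ y, hankelKernel a τ x y * f y ∂omega a

lemma continuous_hankelKernel {a τ : ℝ} (ha : -1 < a) :
    Continuous (Function.uncurry (hankelKernel a τ)) := by
  have := continuous_hyp01 (by linarith : 0 < (a + 1) / 2)
  unfold hankelKernel Function.uncurry
  fun_prop

lemma measurable_hankelTransform {a τ : ℝ} (ha : -1 < a) {f : ℝ → ℂ} (hf : Measurable f) :
    Measurable (hankelTransform a τ f) :=
  (StronglyMeasurable.integral_prod_right' ((Complex.measurable_ofReal.comp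
    (continuous_hankelKernel ha).measurable).mul (hf.comp measurable_snd)).stronglyMeasurable
    ).measurable

lemma exists_abs_hyp01_neg_sq_le {b : ℝ} (hb : 0 < b) :
    ∃ C, 0 < C ∧ ∀ s, |hyp01 b (-s ^ 2)| ≤ C * (1 + |s|) := by
  rcases le_or_gt (1 / 2) b with h | h
  · have hG : 0 < (Gamma b)⁻¹ := inv_pos.2 (Gamma_pos_of_pos hb)
    refine ⟨(Gamma b)⁻¹, hG, fun s => (abs_hyp01_neg_le h (sq_nonneg s)).trans ?_⟩
    exact le_mul_of_one_le_right hG.le (le_add_of_nonneg_right (abs_nonneg s))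
  · obtain ⟨C, hC, hC'⟩ := exists_abs_hyp01_neg_le hb h
    refine ⟨2 * C, by positivity, fun s => (hC' _ (sq_nonneg s)).trans ?_⟩
    have hpow : (s ^ 2) ^ ((1 / 2 - b) / 2) ≤ 1 + |s| :=
      calc (s ^ 2) ^ ((1 / 2 - b) / 2) = |s| ^ (1 / 2 - b) := by
            rw [← sq_abs, ← rpow_natCast_mul (abs_nonneg s)]
            congr 1
            push_cast
            ring
        _ ≤ (1 + |s|) ^ (1 / 2 - b) :=
            rpow_le_rpow (abs_nonneg s) (by linarith) (by linarith)
        _ ≤ 1 + |s| := rpow_le_self_of_one_le (by linarith [abs_nonneg s]) (by linarith)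
    nlinarith [abs_nonneg s]

lemma exists_abs_hankelKernel_le {a τ : ℝ} (ha : -1 < a) (hτ : 0 < τ) :
    ∃ D, 0 < D ∧ ∀ x y, |hankelKernel a τ x y| ≤ D * (1 + |x|) * (1 + |y|) := by
  obtain ⟨C, hC, h⟩ := exists_abs_hyp01_neg_sq_le (by linarith : 0 < (a + 1) / 2)
  set A : ℝ := 2 ^ (1 - (a + 1) / 2) * τ ^ (-((a + 1) / 2)) with hA
  have hA0 : 0 < A := by positivity
  set q := (2 * τ)⁻¹ with hq
  have hq0 : 0 < q := by positivity
  refine ⟨A * (C * (1 + q)), by positivity, fun x y => ?_⟩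
  have hs : |x * y / (2 * τ)| = q * (|x| * |y|) := by
    rw [div_eq_inv_mul, ← hq, abs_mul, abs_mul, abs_of_pos hq0]
  calc |hankelKernel a τ x y|
      = A * |hyp01 ((a + 1) / 2) (-(x * y / (2 * τ)) ^ 2)| := by
        rw [hankelKernel, ← hA, abs_mul, abs_of_pos hA0]
    _ ≤ A * (C * (1 + q * (|x| * |y|))) := by
        gcongr
        exact hs ▸ h _
    _ ≤ A * (C * ((1 + q) * ((1 + |x|) * (1 + |y|)))) := by
        gcongr
        nlinarith [mul_nonneg (abs_nonneg x) (abs_nonneg y), mul_nonneg hq0.le (abs_nonneg x),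
          mul_nonneg hq0.le (abs_nonneg y), abs_nonneg x, abs_nonneg y]
    _ = A * (C * (1 + q)) * (1 + |x|) * (1 + |y|) := by ring

lemma integrable_hankelKernel_mul {a τ : ℝ} (ha : -1 < a) (hτ : 0 < τ) {f : ℝ → ℂ}
    (hf : Measurable f) (hint : Integrable (fun y => (1 + |y|) * ‖f y‖) (omega a)) (x : ℝ) :
    Integrable (fun y => (hankelKernel a τ x y : ℂ) * f y) (omega a) := by
  obtain ⟨D, -, hD⟩ := exists_abs_hankelKernel_le ha hτ
  refine (hint.const_mul (D * (1 + |x|))).mono' (Measurable.aestronglyMeasurable ?_)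
    (ae_of_all _ fun y => ?_)
  · exact (Complex.measurable_ofReal.comp
      ((continuous_hankelKernel ha).measurable.comp measurable_prodMk_left)).mul hf
  · rw [norm_mul, Complex.norm_real, Real.norm_eq_abs, ← mul_assoc]
    gcongr
    exact hD x y

lemma integral_exp_mul_hankelKernel_mul_hankelKernel {a τ ε : ℝ} (ha : -1 < a) (hτ : 0 < τ)
    (hε : 0 < ε) (y z : ℝ) :
    ∫ x, exp (-ε * x ^ 2) * (hankelKernel a τ x y * hankelKernel a τ x z) ∂omega a =
      heatKernel a (4 * τ ^ 2 * ε)⁻¹ y z := by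
  set b := (a + 1) / 2 with hb
  set u := -(y / (2 * τ)) ^ 2 with hu
  set v := -(z / (2 * τ)) ^ 2 with hv
  have hconst : (2 ^ (1 - b) * τ ^ (-b)) ^ 2 * (1 / 2 * ε ^ (-b)) =
      2 * (4 * τ ^ 2 * ε)⁻¹ ^ b := by
    rw [inv_rpow (by positivity), mul_rpow (by positivity) hε.le, mul_rpow (by norm_num)
      (by positivity), rpow_sub two_pos, rpow_one, rpow_neg hτ.le, rpow_neg hε.le,
      show (4 : ℝ) = 2 ^ (2 : ℕ) by norm_num, ← rpow_pow_comm two_pos.le, ← rpow_pow_comm hτ.le]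
    field_simp
  have huε : u / ε = -(4 * τ ^ 2 * ε)⁻¹ * y ^ 2 := by rw [hu]; field_simp; ring
  have hvε : v / ε = -(4 * τ ^ 2 * ε)⁻¹ * z ^ 2 := by rw [hv]; field_simp; ring
  calc ∫ x, exp (-ε * x ^ 2) * (hankelKernel a τ x y * hankelKernel a τ x z) ∂omega a
      = ∫ x, (2 ^ (1 - b) * τ ^ (-b)) ^ 2 *
          (exp (-ε * x ^ 2) * (hyp01 b (u * x ^ 2) * hyp01 b (v * x ^ 2))) ∂omega a := by
        refine integral_congr_ae (ae_of_all _ fun x => ?_)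
        simp only [hankelKernel, ← hb, show -(x * y / (2 * τ)) ^ 2 = u * x ^ 2 by ring,
          show -(x * z / (2 * τ)) ^ 2 = v * x ^ 2 by ring]
        ring
    _ = heatKernel a (4 * τ ^ 2 * ε)⁻¹ y z := by
        rw [integral_const_mul, integral_weber ha hε, ← mul_assoc, ← hb, hconst, huε, hvε,
          heatKernel, ← hb, neg_mul, neg_mul, neg_mul_neg, mul_assoc]

lemma integrable_exp_mul_one_add_abs_sq {a ε : ℝ} (ha : -1 < a) (hε : 0 < ε) :
    Integrable (fun x => exp (-ε * x ^ 2) * (1 + |x|) ^ 2) (omega a) := by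
  refine (((integrable_pow_mul_exp_omega ha hε 0).add
    (integrable_pow_mul_exp_omega ha hε 1)).const_mul 2).mono'
    (Measurable.aestronglyMeasurable (by fun_prop)) (ae_of_all _ fun x => ?_)
  rw [norm_of_nonneg (by positivity)]
  calc exp (-ε * x ^ 2) * (1 + |x|) ^ 2 ≤ exp (-ε * x ^ 2) * (2 * (1 + |x| ^ 2)) := by
        gcongr
        nlinarith [sq_nonneg (1 - |x|)]
    _ = 2 * (x ^ (2 * 0) * exp (-ε * x ^ 2) + x ^ (2 * 1) * exp (-ε * x ^ 2)) := by
        rw [sq_abs]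
        ring

lemma lintegral_exp_mul_hankelTransform_sq_le {a τ ε : ℝ} (ha : -1 < a) (hτ : 0 < τ)
    (hε : 0 < ε) {f : ℝ → ℂ} (hf : Measurable f)
    (hint : Integrable (fun y => (1 + |y|) * ‖f y‖) (omega a)) :
    ∫⁻ x, ENNReal.ofReal (exp (-ε * x ^ 2)) * ‖hankelTransform a τ f x‖ₑ ^ 2 ∂omega a ≤
      ∫⁻ y, ‖f y‖ₑ ^ 2 ∂omega a := by
  have hδ : 0 < (4 * τ ^ 2 * ε)⁻¹ := by positivity
  obtain ⟨D, -, hD⟩ := exists_abs_hankelKernel_le ha hτ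
  set ρ : ℝ → ℝ := fun x => exp (-(ε / 2) * x ^ 2) with hρ
  have hρ2 (x : ℝ) : ρ x ^ 2 = exp (-ε * x ^ 2) := by
    rw [hρ, ← exp_nat_mul]
    congr 1
    push_cast
    ring
  -- The damping factor `exp (-ε x² / 2)` turns the `T T*` kernel into a heat kernel.
  set K : ℝ → ℝ → ℂ := fun x y => (ρ x * hankelKernel a τ x y : ℝ) with hK
  have hKm : Measurable (Function.uncurry K) :=
    Complex.measurable_ofReal.comp (((by fun_prop : Measurable ρ).comp measurable_fst).mul
      (continuous_hankelKernel ha).measurable)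
  have hKD (x y : ℝ) : ‖K x y‖ ≤ ρ x * (D * (1 + |x|)) * (1 + |y|) := by
    rw [hK, Complex.norm_real, norm_mul, norm_of_nonneg (exp_pos _).le, mul_assoc]
    gcongr
    exact hD x y
  have hG (y : ℝ) : ∫⁻ z, ‖∫ x, K x y * conj (K x z) ∂omega a‖ₑ ∂omega a ≤ 1 := by
    refine (lintegral_congr fun z => ?_).trans_le (lintegral_heatKernel ha hδ y).le
    rw [← ofReal_norm, ← norm_of_nonneg (heatKernel_nonneg ha hδ y z), ← Complex.norm_real,
      ← integral_exp_mul_hankelKernel_mul_hankelKernel ha hτ hε, ← integral_complex_ofReal]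
    simp only [hK, Complex.conj_ofReal, ← Complex.ofReal_mul, ← hρ2]
    congr! 5
    ring
  have hρint : Integrable (fun x => (ρ x * (D * (1 + |x|))) ^ 2) (omega a) := by
    refine ((integrable_exp_mul_one_add_abs_sq ha hε).const_mul (D ^ 2)).congr
      (ae_of_all _ fun x => ?_)
    simp only [mul_pow, hρ2]
    ring
  have hKf (x : ℝ) : ‖∫ y, K x y * f y ∂omega a‖ₑ ^ 2 =
      ENNReal.ofReal (exp (-ε * x ^ 2)) * ‖hankelTransform a τ f x‖ₑ ^ 2 := by
    simp only [hK, Complex.ofReal_mul, mul_assoc, integral_const_mul]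
    rw [enorm_mul, mul_pow, ← hρ2, ENNReal.ofReal_pow (exp_pos _).le, ← ofReal_norm,
      Complex.norm_real, norm_of_nonneg (exp_pos _).le, hankelTransform]
  simpa only [hKf, one_mul] using lintegral_enorm_integral_sq_le hKm hf
    (integrable_mul_conj_mul_mul_conj hKm hf hKD hρint hint) hG

theorem lintegral_enorm_hankelTransform_sq_le {a τ : ℝ} (ha : -1 < a) (hτ : 0 < τ) {f : ℝ → ℂ}
    (hf : Measurable f) (hint : Integrable (fun y => (1 + |y|) * ‖f y‖) (omega a)) :
    ∫⁻ x, ‖hankelTransform a τ f x‖ₑ ^ 2 ∂omega a ≤ ∫⁻ y, ‖f y‖ₑ ^ 2 ∂omega a := by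
  set F : ℕ → ℝ → ℝ≥0∞ := fun n x =>
    ENNReal.ofReal (exp (-(1 / ((n : ℝ) + 1)) * x ^ 2)) * ‖hankelTransform a τ f x‖ₑ ^ 2
  have hFm (n : ℕ) : Measurable (F n) := by
    have := measurable_hankelTransform (τ := τ) ha hf
    fun_prop
  have hlim (x : ℝ) : Tendsto (F · x) atTop (𝓝 (‖hankelTransform a τ f x‖ₑ ^ 2)) := by
    have hexp : Tendsto (fun n : ℕ => exp (-(1 / ((n : ℝ) + 1)) * x ^ 2)) atTop (𝓝 1) := by
      simpa only [neg_zero, zero_mul, exp_zero, Function.comp_def] using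
        (continuous_exp.tendsto _).comp
          (tendsto_one_div_add_atTop_nhds_zero_nat (𝕜 := ℝ).neg.mul_const (x ^ 2))
    simpa only [ENNReal.ofReal_one, one_mul] using ENNReal.Tendsto.mul_const
      (ENNReal.tendsto_ofReal hexp) (Or.inl (by simp))
  calc ∫⁻ x, ‖hankelTransform a τ f x‖ₑ ^ 2 ∂omega a
      = ∫⁻ x, liminf (F · x) atTop ∂omega a :=
        lintegral_congr fun x => (hlim x).liminf_eq.symm
    _ ≤ liminf (fun n => ∫⁻ x, F n x ∂omega a) atTop := lintegral_liminf_le hFm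
    _ ≤ ∫⁻ y, ‖f y‖ₑ ^ 2 ∂omega a := by
        refine liminf_le_of_le (by isBoundedDefault) fun c hc => ?_
        obtain ⟨n, hn⟩ := hc.exists
        exact hn.trans (lintegral_exp_mul_hankelTransform_sq_le ha hτ (by positivity) hf hint)

theorem eLpNorm_hankelTransform_mul_rpow_le {a τ B r : ℝ} {κ : ℝ → ℝ} (ha : -1 < a) (hτ : 0 < τ)
    (hr : 2 ≤ r) (hB : 0 < B) (hκ : Measurable κ) (hκ0 : ∀ x, 0 < x → 0 < κ x)
    (hκB : ∀ x y, 0 < x → 0 < y → κ x * |hankelKernel a τ x y| * κ y ≤ B) {f : ℝ → ℂ}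
    (hf : Measurable f) (hint : Integrable (fun y => (1 + |y|) * ‖f y‖) (omega a)) :
    eLpNorm (fun x => hankelTransform a τ f x * ((κ x ^ (1 - 2 / r) : ℝ) : ℂ))
        (ENNReal.ofReal r) (omega a) ≤
      ENNReal.ofReal (interpolationConst r * B ^ (1 - 2 / r)) *
        eLpNorm (fun y => f y * ((κ y ^ (1 - 2 / r.conjExponent) : ℝ) : ℂ))
          (ENNReal.ofReal r.conjExponent) (omega a) := by
  refine eLpNorm_integral_mul_rpow_le (K := fun x y => (hankelKernel a τ x y : ℂ)) hr hB
    (Complex.measurable_ofReal.comp (continuous_hankelKernel ha).measurable) hf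
    (ae_of_all _ (integrable_hankelKernel_mul ha hτ hf hint)) hκ (ae_omega hκ0) hκ
    (ae_omega hκ0) (ae_omega fun x hx => ae_omega fun y hy => ?_) fun A hA => ?_
  · simpa only [Complex.norm_real, Real.norm_eq_abs] using hκB x y hx hy
  · have hintA : Integrable (fun y => (1 + |y|) * ‖A.indicator f y‖) (omega a) := by
      refine (hint.indicator hA).congr (ae_of_all _ fun y => ?_)
      simp only [indicator_mul_right, norm_indicator_eq_indicator_norm]
    have h := lintegral_enorm_hankelTransform_sq_le ha hτ (hf.indicator hA) hintA
    have hsq (y : ℝ) : ‖A.indicator f y‖ₑ ^ 2 = A.indicator (fun y => ‖f y‖ₑ ^ 2) y := by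
      by_cases hy : y ∈ A <;> simp [hy]
    have hset (x : ℝ) : hankelTransform a τ (A.indicator f) x =
        ∫ y in A, hankelKernel a τ x y * f y ∂omega a := by
      simp only [hankelTransform, ← integral_indicator hA, indicator_mul_right]
    simpa only [hset, hsq, lintegral_indicator hA] using h

end Hankel

section Propagator

/-- The unimodular factor `e^(i x² / (4 t))`. Conjugation by it reduces `S_a(t)` to the Hankel
transform dilated by `2 |t|`. -/
def chirp (t x : ℝ) : ℂ := Complex.exp (Complex.I * (x ^ 2 / (4 * t) : ℝ))

lemma norm_chirp (t x : ℝ) : ‖chirp t x‖ = 1 := by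
  rw [chirp, mul_comm, Complex.norm_exp_ofReal_mul_I]

lemma continuous_chirp (t : ℝ) : Continuous (chirp t) := by
  unfold chirp
  fun_prop

lemma chirp_mul_chirp (t x y : ℝ) :
    chirp t x * chirp t y = Complex.exp (Complex.I * ((x ^ 2 + y ^ 2) / (4 * t) : ℝ)) := by
  rw [chirp, chirp, ← Complex.exp_add, ← mul_add, ← Complex.ofReal_add, add_div]

lemma rpow_mul_besselJ (a : ℝ) {z : ℝ} (hz : 0 < z) :
    z ^ ((1 - a) / 2) * besselJ ((a - 1) / 2) z =
      2 ^ (1 - (a + 1) / 2) * hyp01 ((a + 1) / 2) (-(z / 2) ^ 2) := by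
  rw [besselJ, hyp01, ← tsum_mul_left, ← tsum_mul_left]
  refine tsum_congr fun k => ?_
  have hpow : (z / 2) ^ (2 * (k : ℝ) + (a - 1) / 2) =
      ((z / 2) ^ 2) ^ k * ((z ^ ((1 - a) / 2))⁻¹ * 2 ^ ((1 - a) / 2)) := by
    rw [rpow_add (by positivity), show 2 * (k : ℝ) = ((2 * k : ℕ) : ℝ) by push_cast; ring,
      rpow_natCast, pow_mul, div_rpow hz.le two_pos.le,
      show (a - 1) / 2 = -((1 - a) / 2) by ring, rpow_neg hz.le, rpow_neg two_pos.le,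
      div_inv_eq_mul]
  rw [hpow, Gamma_nat_eq_factorial, show (a - 1) / 2 + (k : ℝ) + 1 = (a + 1) / 2 + k by ring,
    show 1 - (a + 1) / 2 = (1 - a) / 2 by ring, neg_pow ((z / 2) ^ 2)]
  have : z ^ ((1 - a) / 2) ≠ 0 := by positivity
  field_simp

lemma hankelKernel_eq_besselJ (a : ℝ) {τ x y : ℝ} (hτ : 0 < τ) (hx : 0 < x) (hy : 0 < y) :
    hankelKernel a τ x y =
      (x * y / τ) ^ ((1 - a) / 2) * besselJ ((a - 1) / 2) (x * y / τ) / τ ^ ((a + 1) / 2) := by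
  rw [rpow_mul_besselJ a (by positivity), hankelKernel, rpow_neg hτ.le, div_div, mul_comm τ 2]
  ring

lemma exists_kernel_eq (a : ℝ) {t : ℝ} (ht : t ≠ 0) :
    ∃ c : ℂ, ‖c‖ = 1 ∧ ∀ x y, 0 < x → 0 < y →
      kernel a x y t = c * chirp t x * (hankelKernel a (2 * |t|) x y * chirp t y) := by
  have ht0 : 0 < 2 * |t| := by positivity
  rcases ht.lt_or_gt with h | h
  · refine ⟨Complex.exp (Complex.I * ((a + 1) * π / 4 : ℝ)), by simp [Complex.norm_exp],
      fun x y hx hy => ?_⟩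
    have hchirp : Complex.exp (-Complex.I * ((x ^ 2 + y ^ 2) / (4 * |t|) : ℝ)) =
        chirp t x * chirp t y := by
      rw [chirp_mul_chirp, abs_of_neg h, mul_neg, div_neg, Complex.ofReal_neg, neg_mul_neg]
    rw [kernel, if_pos h, hankelKernel_eq_besselJ a ht0 hx hy, hchirp]
    push_cast
    ring
  · refine ⟨Complex.exp (-Complex.I * ((a + 1) * π / 4 : ℝ)), by simp [Complex.norm_exp],
      fun x y hx hy => ?_⟩
    have hchirp : Complex.exp (Complex.I * ((x ^ 2 + y ^ 2) / (4 * |t|) : ℝ)) =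
        chirp t x * chirp t y := by
      rw [chirp_mul_chirp, abs_of_pos h]
    rw [kernel, if_neg h.not_gt, hankelKernel_eq_besselJ a ht0 hx hy, hchirp]
    push_cast
    ring

lemma exists_propagator_eq (a : ℝ) {t : ℝ} (ht : t ≠ 0) (φ : ℝ → ℂ) :
    ∃ c : ℂ, ‖c‖ = 1 ∧ ∀ x, 0 < x → propagator a t φ x = c * chirp t x *
      hankelTransform a (2 * |t|) (fun y => chirp t y * (Ioi 0).indicator φ y) x := by
  obtain ⟨c, hc, hker⟩ := exists_kernel_eq a ht
  refine ⟨c, hc, fun x hx => ?_⟩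
  rw [propagator, hankelTransform, ← integral_const_mul]
  refine integral_congr_ae (ae_omega fun y hy => ?_)
  simp only [hker x y hx hy, indicator_of_mem (mem_Ioi.2 hy), mul_assoc]

end Propagator

section Schwartz

lemma SchwartzPlus.exists_pow_mul_norm_le {φ : ℝ → ℂ} (hφ : SchwartzPlus φ) (m : ℕ) :
    ∃ M, 0 < M ∧ ∀ x, 0 < x → x ^ m * ‖φ x‖ ≤ M := by
  obtain ⟨M, hM⟩ := hφ.bounded m 0
  refine ⟨max M 1, by positivity, fun x hx => ((hM x hx).trans (le_max_left _ _)).trans_eq' ?_⟩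
  rw [Function.iterate_zero_apply, norm_mul, norm_pow, Complex.norm_real, norm_of_nonneg hx.le]

lemma SchwartzPlus.exists_one_add_abs_mul_norm_le {φ : ℝ → ℂ} (hφ : SchwartzPlus φ) :
    ∃ M, 0 < M ∧ ∀ x, 0 < x → (1 + |x|) * ‖φ x‖ ≤ M := by
  obtain ⟨M, hM, h⟩ := hφ.exists_pow_mul_norm_le 0
  obtain ⟨M', hM', h'⟩ := hφ.exists_pow_mul_norm_le 1
  refine ⟨M + M', by positivity, fun x hx => ?_⟩
  simpa only [abs_of_pos hx, add_mul, pow_zero, pow_one] using add_le_add (h x hx) (h' x hx)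

lemma SchwartzPlus.integrable {φ : ℝ → ℂ} (hφ : SchwartzPlus φ) {a : ℝ} (ha : -1 < a) :
    Integrable (fun y => (1 + |y|) * ‖φ y‖) (omega a) := by
  rw [integrable_omega_iff, ← Ioc_union_Ioi_eq_Ioi (zero_le_one (α := ℝ))]
  have hcont : ContinuousOn (fun y => (1 + |y|) * ‖φ y‖ * y ^ a) (Ioi 0) := by
    refine ContinuousOn.mul (ContinuousOn.mul (by fun_prop) hφ.smooth.continuousOn.norm) ?_
    exact continuousOn_id.rpow_const fun y hy => Or.inl (ne_of_gt hy)
  refine IntegrableOn.union ?_ ?_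
  · obtain ⟨M, -, h⟩ := hφ.exists_one_add_abs_mul_norm_le
    have hdom : IntegrableOn (fun y : ℝ => M * y ^ a) (Ioc 0 1) :=
      ((intervalIntegrable_iff_integrableOn_Ioc_of_le zero_le_one).1
        (intervalIntegral.intervalIntegrable_rpow' ha)).const_mul M
    refine hdom.mono' ((hcont.mono Ioc_subset_Ioi_self).aestronglyMeasurable measurableSet_Ioc)
      (ae_restrict_of_forall_mem measurableSet_Ioc fun y hy => ?_)
    have hy0 : 0 < y := hy.1
    rw [norm_of_nonneg (by positivity)]
    gcongr
    exact h y hy0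
  · obtain ⟨n, hn⟩ := exists_nat_ge (a + 3)
    obtain ⟨M, -, h⟩ := hφ.exists_pow_mul_norm_le n
    have hdom : IntegrableOn (fun y : ℝ => 2 * M * y ^ (-2 : ℝ)) (Ioi 1) :=
      (integrableOn_Ioi_rpow_of_lt (by norm_num) one_pos).const_mul _
    refine hdom.mono' ((hcont.mono (Ioi_subset_Ioi zero_le_one)).aestronglyMeasurable
      measurableSet_Ioi) (ae_restrict_of_forall_mem measurableSet_Ioi fun y (hy : 1 < y) => ?_)
    have hy0 : 0 < y := by linarith
    have hpow : y * y ^ a ≤ y ^ n * y ^ (-2 : ℝ) := by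
      rw [← rpow_one_add' hy0.le (by linarith), ← rpow_natCast, ← rpow_add hy0]
      exact rpow_le_rpow_of_exponent_le hy.le (by linarith)
    rw [norm_of_nonneg (by positivity), abs_of_pos hy0]
    calc (1 + y) * ‖φ y‖ * y ^ a ≤ 2 * y * ‖φ y‖ * y ^ a := by gcongr; linarith
      _ = 2 * ‖φ y‖ * (y * y ^ a) := by ring
      _ ≤ 2 * ‖φ y‖ * (y ^ n * y ^ (-2 : ℝ)) := by gcongr
      _ = 2 * (y ^ n * ‖φ y‖) * y ^ (-2 : ℝ) := by ring
      _ ≤ 2 * M * y ^ (-2 : ℝ) := by gcongr; exact h y hy0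

lemma SchwartzPlus.measurable_indicator {φ : ℝ → ℂ} (hφ : SchwartzPlus φ) :
    Measurable ((Ioi 0).indicator φ) := by
  classical
  rw [← piecewise_eq_indicator]
  exact hφ.smooth.continuousOn.measurable_piecewise continuousOn_const measurableSet_Ioi

lemma SchwartzPlus.measurable_chirp_mul_indicator {φ : ℝ → ℂ} (hφ : SchwartzPlus φ) (t : ℝ) :
    Measurable fun y => chirp t y * (Ioi 0).indicator φ y :=
  (continuous_chirp t).measurable.mul hφ.measurable_indicator

lemma SchwartzPlus.integrable_chirp_mul_indicator {φ : ℝ → ℂ} (hφ : SchwartzPlus φ) {a : ℝ}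
    (ha : -1 < a) (t : ℝ) :
    Integrable (fun y => (1 + |y|) * ‖chirp t y * (Ioi 0).indicator φ y‖) (omega a) := by
  refine (hφ.integrable ha).congr (ae_omega fun y hy => ?_)
  simp only [norm_mul, norm_chirp, one_mul, indicator_of_mem (mem_Ioi.2 hy)]

lemma SchwartzPlus.integrable_kernel_mul {φ : ℝ → ℂ} (hφ : SchwartzPlus φ) {a t x : ℝ}
    (ha : -1 < a) (ht : t ≠ 0) (hx : 0 < x) :
    Integrable (fun y => kernel a x y t * φ y) (omega a) := by
  obtain ⟨c, -, hker⟩ := exists_kernel_eq a ht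
  refine ((integrable_hankelKernel_mul ha (by positivity : 0 < 2 * |t|)
    (hφ.measurable_chirp_mul_indicator t) (hφ.integrable_chirp_mul_indicator ha t) x).const_mul
    (c * chirp t x)).congr (ae_omega fun y hy => ?_)
  simp only [hker x y hx hy, indicator_of_mem (mem_Ioi.2 hy), mul_assoc]

lemma SchwartzPlus.normLa_mul_rpow_lt_top {φ : ℝ → ℂ} (hφ : SchwartzPlus φ) {a p : ℝ}
    (ha : -1 < a) (hp : 1 ≤ p) {κ : ℝ → ℝ} (hκ0 : ∀ x, 0 < x → 0 < κ x)
    (hκ1 : ∀ x, 0 < x → κ x ≤ 1) (hκ : ∀ x, 0 < x → 1 ≤ κ x * (1 + x)) :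
    normLa a p (fun x => φ x * ((κ x ^ (1 - 2 / p) : ℝ) : ℂ)) < ⊤ := by
  have hp0 : 0 < p := by linarith
  obtain ⟨M, _, hφM⟩ := hφ.exists_one_add_abs_mul_norm_le
  have hweight (x : ℝ) (hx : 0 < x) : κ x ^ (1 - 2 / p) ≤ 1 + |x| := by
    have hexp : -1 ≤ 1 - 2 / p := by
      have : 2 / p ≤ 2 := by rw [div_le_iff₀ hp0]; linarith
      linarith
    calc κ x ^ (1 - 2 / p) ≤ κ x ^ (-1 : ℝ) :=
          rpow_le_rpow_of_exponent_ge (hκ0 x hx) (hκ1 x hx) hexp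
      _ ≤ 1 + |x| := by
          rw [rpow_neg_one, abs_of_pos hx, inv_le_iff_one_le_mul₀' (hκ0 x hx)]
          exact hκ x hx
  rw [normLa, eLpNorm_ofReal_eq hp0]
  refine ENNReal.rpow_lt_top_of_nonneg (by positivity) (ne_of_lt ?_)
  refine (lintegral_mono_ae (ae_omega fun x hx => ?_)).trans_lt
    ((hφ.integrable ha).const_mul (M ^ (p - 1))).lintegral_lt_top
  rw [← ofReal_norm, ENNReal.ofReal_rpow_of_nonneg (norm_nonneg _) hp0.le, norm_mul,
    Complex.norm_real, norm_of_nonneg (rpow_nonneg (hκ0 x hx).le _)]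
  refine ENNReal.ofReal_le_ofReal ?_
  calc (‖φ x‖ * κ x ^ (1 - 2 / p)) ^ p ≤ ((1 + |x|) * ‖φ x‖) ^ p := by
        have := rpow_nonneg (hκ0 x hx).le (1 - 2 / p)
        rw [mul_comm]
        gcongr
        exact hweight x hx
    _ = ((1 + |x|) * ‖φ x‖) ^ (p - 1) * ((1 + |x|) * ‖φ x‖) := by
        rw [← rpow_add_one' (by positivity) (by linarith), sub_add_cancel]
    _ ≤ M ^ (p - 1) * ((1 + |x|) * ‖φ x‖) := by
        gcongr
        exact hφM x hx

end Schwartz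

section Dispersive

theorem SchwartzPlus.memLa_propagator_mul_rpow {φ : ℝ → ℂ} (hφ : SchwartzPlus φ) {a t B r : ℝ}
    {κ : ℝ → ℝ} (hr : 2 ≤ r) (ha : -1 < a) (ht : t ≠ 0) (hB : 0 < B) (hκ : Measurable κ)
    (hκ0 : ∀ x, 0 < x → 0 < κ x) (hκ1 : ∀ x, 0 < x → κ x ≤ 1)
    (hκ2 : ∀ x, 0 < x → 1 ≤ κ x * (1 + x))
    (hκB : ∀ x y, 0 < x → 0 < y → κ x * |hankelKernel a (2 * |t|) x y| * κ y ≤ B) :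
    MemLa a r (fun x => propagator a t φ x * ((κ x ^ (1 - 2 / r) : ℝ) : ℂ)) ∧
      normLa a r (fun x => propagator a t φ x * ((κ x ^ (1 - 2 / r) : ℝ) : ℂ)) ≤
        ENNReal.ofReal (interpolationConst r * B ^ (1 - 2 / r)) *
          normLa a r.conjExponent
            (fun x => φ x * ((κ x ^ (1 - 2 / r.conjExponent) : ℝ) : ℂ)) := by
  obtain ⟨c, hc, hprop⟩ := exists_propagator_eq a ht φ
  set f : ℝ → ℂ := fun y => chirp t y * (Ioi 0).indicator φ y with hf
  have hfm : Measurable f := hφ.measurable_chirp_mul_indicator t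
  have hmeas : AEStronglyMeasurable (fun x => propagator a t φ x *
      ((κ x ^ (1 - 2 / r) : ℝ) : ℂ)) (omega a) := by
    refine AEStronglyMeasurable.congr (f := fun x => c * chirp t x *
      hankelTransform a (2 * |t|) f x * ((κ x ^ (1 - 2 / r) : ℝ) : ℂ)) ?_
      (ae_omega fun x hx => by simp only [hprop x hx])
    exact ((((continuous_chirp t).measurable.const_mul c).mul
      (measurable_hankelTransform ha hfm)).mul
      (Complex.measurable_ofReal.comp (hκ.pow_const _))).aestronglyMeasurable
  have hnorm : normLa a r (fun x => propagator a t φ x * ((κ x ^ (1 - 2 / r) : ℝ) : ℂ)) ≤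
      ENNReal.ofReal (interpolationConst r * B ^ (1 - 2 / r)) * normLa a r.conjExponent
        (fun x => φ x * ((κ x ^ (1 - 2 / r.conjExponent) : ℝ) : ℂ)) := by
    convert eLpNorm_hankelTransform_mul_rpow_le ha (by positivity : 0 < 2 * |t|) hr hB hκ hκ0 hκB
      hfm (hφ.integrable_chirp_mul_indicator ha t) using 2
    · refine eLpNorm_congr_norm_ae (ae_omega fun x hx => ?_)
      rw [hprop x hx, norm_mul, norm_mul, norm_mul, norm_mul, hc, norm_chirp, one_mul, one_mul]
    · refine eLpNorm_congr_norm_ae (ae_omega fun x hx => ?_)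
      rw [hf, norm_mul, norm_mul, norm_mul, norm_chirp, one_mul, indicator_of_mem (mem_Ioi.2 hx)]
  refine ⟨⟨hmeas, hnorm.trans_lt (ENNReal.mul_lt_top ENNReal.ofReal_lt_top ?_)⟩, hnorm⟩
  exact hφ.normLa_mul_rpow_lt_top ha
    (HolderConjugate.conjExponent (by linarith)).symm.lt.le hκ0 hκ1 hκ2

lemma abs_hankelKernel_two_mul_le {a s : ℝ} (ha : -1 < a) (hs : 0 < s) (x y : ℝ) :
    |hankelKernel a (2 * s) x y| ≤ 2 ^ (1 - (a + 1) / 2) * s ^ (-((a + 1) / 2)) *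
      |hyp01 ((a + 1) / 2) (-(x * y / (4 * s)) ^ 2)| := by
  rw [hankelKernel, abs_mul, abs_of_pos (by positivity), show 2 * (2 * s) = 4 * s by ring]
  gcongr _ * ?_ * _
  exact rpow_le_rpow_of_nonpos hs (by linarith) (by linarith)

lemma exists_abs_hankelKernel_le_rpow {a : ℝ} (ha : 0 ≤ a) :
    ∃ D, 0 < D ∧ ∀ s, 0 < s → ∀ x y,
      |hankelKernel a (2 * s) x y| ≤ D * s ^ (-((a + 1) / 2)) := by
  have : 0 < (Gamma ((a + 1) / 2))⁻¹ := inv_pos.2 (Gamma_pos_of_pos (by linarith))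
  refine ⟨2 ^ (1 - (a + 1) / 2) * (Gamma ((a + 1) / 2))⁻¹, by positivity, fun s hs x y => ?_⟩
  refine (abs_hankelKernel_two_mul_le (by linarith) hs x y).trans ?_
  rw [mul_right_comm]
  gcongr
  exact abs_hyp01_neg_le (by linarith) (sq_nonneg _)

lemma measurable_k₁ (a : ℝ) : Measurable (k₁ a) := by
  unfold k₁
  fun_prop

lemma k₁_pos (a : ℝ) {x : ℝ} (hx : 0 < x) : 0 < k₁ a x := lt_min one_pos (rpow_pos_of_pos hx _)

lemma k₁_le_one (a x : ℝ) : k₁ a x ≤ 1 := min_le_left _ _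

lemma k₁_mul_rpow_le_one (a : ℝ) {x : ℝ} (hx : 0 < x) : k₁ a x * x ^ (-(a / 2)) ≤ 1 := by
  rw [rpow_neg hx.le, ← div_eq_mul_inv, div_le_one (rpow_pos_of_pos hx _)]
  exact min_le_right _ _

lemma one_le_k₁_mul_one_add {a x : ℝ} (ha : -1 < a) (ha0 : a < 0) (hx : 0 < x) :
    1 ≤ k₁ a x * (1 + x) := by
  rw [k₁, min_mul_of_nonneg _ _ (by linarith)]
  refine le_min (by linarith) ?_
  have hpow : x ^ (-(a / 2)) ≤ 1 + x :=
    calc x ^ (-(a / 2)) ≤ (1 + x) ^ (-(a / 2)) := rpow_le_rpow hx.le (by linarith) (by linarith)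
      _ ≤ 1 + x := rpow_le_self_of_one_le (by linarith) (by linarith)
  rwa [rpow_neg hx.le, inv_le_iff_one_le_mul₀' (rpow_pos_of_pos hx _)] at hpow

lemma div_sq_rpow_le {a s x y : ℝ} (ha : a ≤ 0) (hs : 0 < s) (hx : 0 < x) (hy : 0 < y) :
    ((x * y / (4 * s)) ^ 2) ^ (-(a / 2) / 2) ≤ x ^ (-(a / 2)) * y ^ (-(a / 2)) * s ^ (a / 2) :=
  calc ((x * y / (4 * s)) ^ 2) ^ (-(a / 2) / 2) = (x * y * (4 * s)⁻¹) ^ (-(a / 2)) := by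
        rw [← rpow_natCast_mul (by positivity), div_eq_mul_inv, Nat.cast_ofNat,
          mul_div_cancel₀ _ two_ne_zero]
    _ ≤ (x * y * s⁻¹) ^ (-(a / 2)) := by
        gcongr
        · linarith
        · linarith
    _ = x ^ (-(a / 2)) * y ^ (-(a / 2)) * s ^ (a / 2) := by
        rw [mul_rpow (by positivity) (by positivity), mul_rpow hx.le hy.le, inv_rpow hs.le,
          ← rpow_neg hs.le, neg_neg]

lemma exists_k₁_mul_abs_hankelKernel_mul_k₁_le {a : ℝ} (ha : -1 < a) (ha0 : a < 0) :
    ∃ D, 0 < D ∧ ∀ s, 0 < s → ∀ x y, 0 < x → 0 < y →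
      k₁ a x * |hankelKernel a (2 * s) x y| * k₁ a y ≤
        D * (s ^ (-((a + 1) / 2)) + s ^ (-(1 / 2 : ℝ))) := by
  obtain ⟨C, hC, h⟩ := exists_abs_hyp01_neg_le (b := (a + 1) / 2) (by linarith) (by linarith)
  refine ⟨2 ^ (1 - (a + 1) / 2) * C, by positivity, fun s hs x y hx hy => ?_⟩
  set b := (a + 1) / 2 with hb
  set z := x * y / (4 * s)
  have hpow : (z ^ 2) ^ ((1 / 2 - b) / 2) ≤ x ^ (-(a / 2)) * y ^ (-(a / 2)) * s ^ (a / 2) := by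
    rw [show (1 / 2 - b) / 2 = -(a / 2) / 2 by rw [hb]; ring]
    exact div_sq_rpow_le ha0.le hs hx hy
  have hsb : s ^ (-b) * s ^ (a / 2) = s ^ (-(1 / 2 : ℝ)) := by
    rw [← rpow_add hs, hb]
    ring_nf
  have hx0 := k₁_pos a hx
  have hy0 := k₁_pos a hy
  have hone : k₁ a x * k₁ a y ≤ 1 := mul_le_one₀ (k₁_le_one a x) hy0.le (k₁_le_one a y)
  have hcancel : k₁ a x * x ^ (-(a / 2)) * (k₁ a y * y ^ (-(a / 2))) ≤ 1 :=
    mul_le_one₀ (k₁_mul_rpow_le_one a hx) (by positivity) (k₁_mul_rpow_le_one a hy)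
  calc k₁ a x * |hankelKernel a (2 * s) x y| * k₁ a y
      ≤ k₁ a x * (2 ^ (1 - b) * s ^ (-b) * |hyp01 b (-z ^ 2)|) * k₁ a y := by
        gcongr
        exact abs_hankelKernel_two_mul_le ha hs x y
    _ ≤ k₁ a x * (2 ^ (1 - b) * s ^ (-b) *
          (C * (1 + x ^ (-(a / 2)) * y ^ (-(a / 2)) * s ^ (a / 2)))) * k₁ a y := by
        gcongr
        exact (h _ (sq_nonneg z)).trans (by gcongr)
    _ = 2 ^ (1 - b) * C * s ^ (-b) * (k₁ a x * k₁ a y +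
          k₁ a x * x ^ (-(a / 2)) * (k₁ a y * y ^ (-(a / 2))) * s ^ (a / 2)) := by ring
    _ ≤ 2 ^ (1 - b) * C * s ^ (-b) * (1 + 1 * s ^ (a / 2)) := by gcongr
    _ = _ := by rw [one_mul, mul_assoc, mul_add (s ^ (-b)), mul_one, hsb]

lemma mul_rpow_add_rpow_rpow_le {D s θ : ℝ} (hD : 0 ≤ D) (hs : 0 ≤ s) (c d : ℝ) (hθ0 : 0 ≤ θ)
    (hθ1 : θ ≤ 1) : (D * (s ^ c + s ^ d)) ^ θ ≤ D ^ θ * (s ^ (c * θ) + s ^ (d * θ)) := by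
  have hc := rpow_nonneg hs c
  have hd := rpow_nonneg hs d
  rw [mul_rpow hD (add_nonneg hc hd), rpow_mul hs, rpow_mul hs]
  gcongr
  exact rpow_add_le_add_rpow hc hd hθ0 hθ1

end Dispersive

end BesselSchrodinger

end

open BesselSchrodinger in
theorem proposition3p4 (r : ℝ) (hr : 2 ≤ r) :
    (∀ a : ℝ, 0 ≤ a → ∃ C : ℝ, 0 < C ∧ ∀ φ : ℝ → ℂ, SchwartzPlus φ → ∀ t : ℝ, t ≠ 0 →
      (∀ x : ℝ, 0 < x → Integrable (fun y => kernel a x y t * φ y) (omega a)) ∧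
      MemLa a r (propagator a t φ) ∧
      normLa a r (propagator a t φ) ≤
        ENNReal.ofReal (C * |t| ^ (-((a + 1) * (1 / 2 - 1 / r)))) *
          normLa a r.conjExponent φ) ∧
    (∀ a : ℝ, -1 < a → a < 0 → ∃ C : ℝ, 0 < C ∧ ∀ φ : ℝ → ℂ, SchwartzPlus φ → ∀ t : ℝ, t ≠ 0 →
      (∀ x : ℝ, 0 < x → Integrable (fun y => kernel a x y t * φ y) (omega a)) ∧
      MemLa a r (weighted a (1 - 2 / r) (propagator a t φ)) ∧
      normLa a r (weighted a (1 - 2 / r) (propagator a t φ)) ≤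
        ENNReal.ofReal
            (C * (|t| ^ (-((a + 1) * (1 / 2 - 1 / r))) + |t| ^ (-(1 / 2 - 1 / r)))) *
          normLa a r.conjExponent (weighted a (1 - 2 / r.conjExponent) φ)) := by
  have hK := one_pos.trans_le (one_le_interpolationConst r)
  have hexp (c : ℝ) : -(c * (1 / 2 - 1 / r)) = -(c / 2) * (1 - 2 / r) := by ring
  refine ⟨fun a ha => ?_, fun a ha ha0 => ?_⟩
  · obtain ⟨D, hD, hker⟩ := exists_abs_hankelKernel_le_rpow ha
    refine ⟨interpolationConst r * D ^ (1 - 2 / r), by positivity, fun φ hφ t ht =>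
      ⟨fun x hx => hφ.integrable_kernel_mul (by linarith) ht hx, ?_⟩⟩
    have h := hφ.memLa_propagator_mul_rpow (a := a) (κ := fun _ => 1)
      (B := D * |t| ^ (-((a + 1) / 2))) hr (by linarith) ht (by positivity) measurable_const
      (fun _ _ => one_pos) (fun _ _ => le_rfl) (fun x hx => by linarith)
      fun x y _ _ => by simpa using hker |t| (by positivity) x y
    simp only [Real.one_rpow, Complex.ofReal_one, mul_one] at h
    rwa [Real.mul_rpow hD.le (by positivity), ← Real.rpow_mul (abs_nonneg t), ← hexp,
      ← mul_assoc] at h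
  · obtain ⟨D, hD, hker⟩ := exists_k₁_mul_abs_hankelKernel_mul_k₁_le ha ha0
    refine ⟨interpolationConst r * D ^ (1 - 2 / r), by positivity, fun φ hφ t ht =>
      ⟨fun x hx => hφ.integrable_kernel_mul ha ht hx, ?_⟩⟩
    have h := hφ.memLa_propagator_mul_rpow hr ha ht (by positivity)
      (measurable_k₁ a) (fun x => k₁_pos a) (fun x _ => k₁_le_one a x)
      (fun x => one_le_k₁_mul_one_add ha ha0) (hker |t| (by positivity))
    refine ⟨h.1, h.2.trans (mul_le_mul_left (ENNReal.ofReal_le_ofReal ?_) _)⟩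
    rw [hexp, ← one_mul (1 / 2 - 1 / r), hexp, mul_assoc]
    gcongr
    exact mul_rpow_add_rpow_rpow_le hD.le (abs_nonneg t) _ _
      (sub_nonneg.2 ((div_le_one (by linarith)).2 hr)) (sub_le_self _ (by positivity))
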